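/- **System.** There are $n$ sequential nodes $p_1,\dots,p_n$, of which at most $t<n/2$ may crash in a run. Any node can send messages to any node (including itself) over reliable, not necessarily FIFO, asynchronous channels: every message sent to a node that does not crash is received after a finite, unbounded delay, and nothing is lost, altered, duplicated or created. A node that crashes in the middle of a broadcast has sent the message to an arbitrary subset of the nodes. One fixed node is the writer. A correct node is one that does not crash. **Algorithm.** Each $p_i$ has variables $reg_i,res_i$ (initially the initial value $\bot$ of the register) and $wsn_i,rsn_i,swsn_i$ (initially $0$). - *write$(v)$* (by the writer only): $wsn_i\gets wsn_i+1$; $reg_i\gets v$; broadcast WRITE$(wsn_i,v)$; wait until WRITE$(wsn_i,-)$ has been received from $n-t$ different nodes; return. - *read$()$*: $rsn_i\gets rsn_i+1$; broadcast READ$(rsn_i)$; wait until messages STATE$(rsn_i,-,-)$ have been received from $n-t$ different nodes and $swsn_i\ge maxwsn$, where $maxwsn$ is the greatest write sequence number in the messages STATE$(rsn_i,-,-)$ received; return $res_i$. The writer may instead directly return $reg_i$. - *On reception of WRITE$(wsn,v)$ or STATE$(rsn,wsn,v)$* (the latter is treated as a message WRITE$(wsn,v)$ from its sender, and then used in the waiting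 predicate of read): if $wsn>wsn_i$ then $reg_i\gets v$ and $wsn_i\gets wsn$; if $p_i$ has not yet broadcast WRITE$(wsn,-)$, it broadcasts WRITE$(wsn,v)$; if WRITE$(wsn,-)$ has been received from $n-t$ different nodes and $wsn>swsn_i$ then $swsn_i\gets wsn$ and $res_i\gets v$. - *On reception of READ$(rsn)$ from $p_j$*: send STATE$(rsn,wsn_i,reg_i)$ to $p_j$. **Theorem.** For $t<n/2$, this algorithm implements a single-writer multi-reader atomic register with time-efficient operations. That is, in every run: 1. (Liveness) every operation invoked by a correct node terminates. 2. (Atomicity) all operations that terminate, and possibly some that do not (each the last operation invoked by a node that crashes), can be arranged in a sequence in which an operation that terminated before another one started comes before it, and in which each read returns the value written by the closest preceding write (the initial value if there is none). 3. (Time-efficiency) Suppose that every message takes at most $\Delta$ time units and that local computation takes no time. Let a read start at time $\tau_r$. It is *write-latency-free* if it is not concurrent with a write and the closest preceding write (if any) started at a time $\tau_w<\tau_r-\Delta$ and the writer did not crash during it. A write is *interfering* with the read if it is the closest write that started before the read, or is concurrent with the read, and it started at a time $\tau_w\ge\tau_r-\Delta$. Then (an operation whose invoker crashes before the stated time has elapsed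 being exempt): - every write takes at most $2\Delta$; - every write-latency-free read takes at most $2\Delta$; - every read that is not write-latency-free takes at most $3\Delta$ if the writer does not crash while executing a write interfering with it, and at most $4\Delta$ if the writer does; - for each node, at most one of its reads takes more than $3\Delta$. -/

import Mathlib

namespace SWMR

/-! ### The algorithm: messages, local states and local transitions -/

/-- Message payloads. -/
inductive Msg (V : Type*) where
  | write (wsn : ℕ) (v : V)
  | read (rsn : ℕ)
  | state (rsn wsn : ℕ) (v : V)

/-- Where a node stands in its (sequential) client code. -/
inductive Client where
  | idle
  /-- waiting inside `write` -/
  | writing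
  /-- waiting inside `read` -/
  | reading
  /-- inside a `read` of the writer that directly returns its `reg` -/
  | readingLocal

/-- Local state of a node. -/
structure LState (n : ℕ) (V : Type*) where
  reg : V
  wsn : ℕ
  rsn : ℕ
  swsn : ℕ
  /-- the value whose sequence number is `swsn` -/
  res : V
  /-- `acks x`: the nodes from which `WRITE(x,-)` (or a `STATE(-,x,-)`, which is handled as a
  `WRITE(x,-)`) has been received -/
  acks : ℕ → Finset (Fin n)
  /-- the sequence numbers `x` for which this node has already broadcast `WRITE(x,-)` -/
  done : Finset ℕ
  /-- `reports r`: the pairs `(q, x)` such that a message `STATE(r,x,-)` has been received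
  from `q` -/
  reports : ℕ → Finset (Fin n × ℕ)
  client : Client
  crashed : Bool

variable {n : ℕ} {V : Type*}

/-- Initial local state; `v₀` is the initial value of the register. -/
def LState.start (n : ℕ) (v₀ : V) : LState n V where
  reg := v₀
  wsn := 0
  rsn := 0
  swsn := 0
  res := v₀
  acks := fun _ => ∅
  done := ∅
  reports := fun _ => ∅
  client := .idle
  crashed := false

/-- The messages to be emitted by one local step, as pairs (destination, payload). -/
abbrev Out (n : ℕ) (V : Type*) := Set (Fin n × Msg V)

/-- Send `m` to every node, including oneself. -/
def bcast (m : Msg V) : Out n V := {x | x.2 = m}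

/-- State after the lines executed on reception of `WRITE(wsn,v)` from `src`.
(The test "not already done" in front of the update of `swsn` is subsumed by `swsn < wsn`.) -/
def LState.onWrite (t : ℕ) (s : LState n V) (src : Fin n) (wsn : ℕ) (v : V) : LState n V :=
  let s₁ : LState n V := if s.wsn < wsn then { s with reg := v, wsn := wsn } else s
  let s₂ : LState n V := { s₁ with
    done := insert wsn s₁.done
    acks := Function.update s₁.acks wsn (insert src (s₁.acks wsn)) }
  if n - t ≤ (s₂.acks wsn).card ∧ s₂.swsn < wsn then { s₂ with swsn := wsn, res := v } else s₂

/-- Messages emitted on reception of `WRITE(wsn,v)`: it is forwarded unless already done. -/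
def LState.onWriteOut (s : LState n V) (wsn : ℕ) (v : V) : Out n V :=
  if s.wsn < wsn ∨ wsn ∉ s.done then bcast (.write wsn v) else ∅

/-- State after the reception of a message from `src`. A message `STATE(rsn,wsn,v)` is first
handled exactly as `WRITE(wsn,v)`, and then recorded for the waiting predicate of `read`. -/
def LState.onRecv (t : ℕ) (s : LState n V) (src : Fin n) : Msg V → LState n V
  | .write wsn v => s.onWrite t src wsn v
  | .read _ => s
  | .state rsn wsn v =>
      let s' := s.onWrite t src wsn v
      { s' with reports := Function.update s'.reports rsn (insert (src, wsn) (s'.reports rsn)) }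

/-- Messages emitted on the reception of a message from `src`. -/
def LState.onRecvOut (s : LState n V) (src : Fin n) : Msg V → Out n V
  | .write wsn v => s.onWriteOut wsn v
  | .read rsn => {(src, .state rsn s.wsn s.reg)}
  | .state _ wsn v => s.onWriteOut wsn v

/-- What a node may do in one step. -/
inductive Event (n : ℕ) (V : Type*) where
  | invWrite (v : V)
  | invRead
  /-- invocation of a `read` by the writer, which chooses to directly return its `reg` -/
  | invReadLocal
  /-- reception of the message `m` that `src` sent in step `k` -/
  | recv (k : ℕ) (src : Fin n) (m : Msg V)
  | retWrite
  | retRead (v : V)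
  /-- nothing but a crash -/
  | halt

/-- Waiting predicate of `write`: `WRITE(wsn,-)` received from `n - t` different nodes. -/
def LState.writeReady (t : ℕ) (s : LState n V) : Prop :=
  n - t ≤ (s.acks s.wsn).card

/-- Waiting predicate of `read`: `STATE(rsn,-,-)` received from `n - t` different nodes, and `swsn`
at least the greatest write sequence number in these messages. -/
def LState.readReady (t : ℕ) (s : LState n V) : Prop :=
  n - t ≤ ((s.reports s.rsn).image Prod.fst).card ∧ ∀ x ∈ s.reports s.rsn, x.2 ≤ s.swsn

/-- Local state after an event (if the node does not crash in that step). -/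
def LState.after (t : ℕ) (s : LState n V) : Event n V → LState n V
  | .invWrite v => { s with
      wsn := s.wsn + 1, reg := v, done := insert (s.wsn + 1) s.done, client := .writing }
  | .invRead => { s with rsn := s.rsn + 1, client := .reading }
  | .invReadLocal => { s with client := .readingLocal }
  | .recv _ src m => s.onRecv t src m
  | .retWrite => { s with client := .idle }
  | .retRead _ => { s with client := .idle }
  | .halt => s

/-- Messages that the code prescribes to emit in an event. -/
def LState.out (s : LState n V) : Event n V → Out n V
  | .invWrite v => bcast (.write (s.wsn + 1) v)
  | .invRead => bcast (.read (s.rsn + 1))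
  | .recv _ src m => s.onRecvOut src m
  | _ => ∅

/-! ### The distributed system: configurations and runs -/

/-- A message in transit: the step in which it was sent, its sender, destination, payload. -/
structure Packet (n : ℕ) (V : Type*) where
  sentAt : ℕ
  src : Fin n
  dst : Fin n
  msg : Msg V

/-- Global configuration. -/
structure Config (n : ℕ) (V : Type*) where
  node : Fin n → LState n V
  transit : Set (Packet n V)

/-- One step of the system: node `who` performs `event`, emitting the messages in `sent`;
`crash` tells whether it crashes while performing (or right after) that event. -/
structure Label (n : ℕ) (V : Type*) where
  who : Fin n
  event : Event n V
  crash : Bool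
  sent : Out n V

/-- The precondition of an event of node `p`; `w` is the writer. Clients are sequential. -/
def Guard (t : ℕ) (w : Fin n) (c : Config n V) (p : Fin n) : Event n V → Prop
  | .invWrite _ => p = w ∧ (c.node p).client = .idle
  | .invRead => (c.node p).client = .idle
  | .invReadLocal => p = w ∧ (c.node p).client = .idle
  | .recv k src m => (⟨k, src, p, m⟩ : Packet n V) ∈ c.transit
  | .retWrite => (c.node p).client = .writing ∧ (c.node p).writeReady t
  | .retRead v =>
      ((c.node p).client = .reading ∧ (c.node p).readReady t ∧ v = (c.node p).res) ∨
      ((c.node p).client = .readingLocal ∧ v = (c.node p).reg)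
  | .halt => True

/-- Step `l` is possible in `c`. A node that does not crash in the step sends all the prescribed
messages; one that crashes in the step sends an arbitrary subset of them. -/
def Allowed (t : ℕ) (w : Fin n) (c : Config n V) (l : Label n V) : Prop :=
  (c.node l.who).crashed = false ∧ Guard t w c l.who l.event ∧
  (l.event = .halt → l.crash = true) ∧
  l.sent ⊆ (c.node l.who).out l.event ∧
  (l.crash = false → l.sent = (c.node l.who).out l.event)

/-- The messages in transit that are consumed by an event of node `p`. -/
def consumed (p : Fin n) : Event n V → Set (Packet n V)
  | .recv k src m => {⟨k, src, p, m⟩}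
  | _ => ∅

/-- The configuration reached from `c` by step number `k`, labelled `l`. -/
def Config.next (t : ℕ) (k : ℕ) (c : Config n V) (l : Label n V) : Config n V where
  node := Function.update c.node l.who
    { (c.node l.who).after t l.event with crashed := l.crash }
  transit := (c.transit \ consumed l.who l.event) ∪
    {pk | pk.sentAt = k ∧ pk.src = l.who ∧ (pk.dst, pk.msg) ∈ l.sent}

/-- A schedule: the step number `k` is `H k`; nothing happens in it if `H k = none`
(so that finite runs are covered as well). -/
abbrev Schedule (n : ℕ) (V : Type*) := ℕ → Option (Label n V)

/-- The configuration before step number `k`. -/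
def configAt (t : ℕ) (v₀ : V) (H : Schedule n V) : ℕ → Config n V
  | 0 => { node := fun _ => LState.start n v₀, transit := ∅ }
  | k + 1 =>
      match H k with
      | none => configAt t v₀ H k
      | some l => (configAt t v₀ H k).next t k l

/-- In step `k`, node `p` performs the event `e`. -/
def Does (H : Schedule n V) (k : ℕ) (p : Fin n) (e : Event n V) : Prop :=
  ∃ l, H k = some l ∧ l.who = p ∧ l.event = e

/-- Node `p` crashes in step `k`. -/
def CrashesAt (H : Schedule n V) (k : ℕ) (p : Fin n) : Prop :=
  ∃ l, H k = some l ∧ l.who = p ∧ l.crash = true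

/-- A node is faulty in a run if it crashes in it, and correct otherwise. -/
def Faulty (H : Schedule n V) (p : Fin n) : Prop := ∃ k, CrashesAt H k p

/-- Node `p` has not crashed and has an operation that can return in configuration `c`. -/
def CanReturn (t : ℕ) (w : Fin n) (c : Config n V) (p : Fin n) : Prop :=
  (c.node p).crashed = false ∧
  (Guard t w c p .retWrite ∨ ∃ v, Guard t w c p (.retRead v))

/-- Node `p` returns from an operation in step `k`. -/
def Responds (H : Schedule n V) (k : ℕ) (p : Fin n) : Prop :=
  Does H k p .retWrite ∨ ∃ v, Does H k p (.retRead v)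

/-- The runs of the algorithm, with writer `w` and initial value `v₀`, in the asynchronous
message-passing system of `n` nodes of which at most `t` may crash. -/
structure IsRun (t : ℕ) (w : Fin n) (v₀ : V) (H : Schedule n V) : Prop where
  /-- every step follows the algorithm -/
  allowed : ∀ k l, H k = some l → Allowed t w (configAt t v₀ H k) l
  /-- at most `t` nodes crash -/
  crashes : {p | Faulty H p}.ncard ≤ t
  /-- channels are reliable: a message sent to a correct node is eventually received -/
  reliable : ∀ k l, H k = some l → ∀ d m, (d, m) ∈ l.sent → ¬ Faulty H d →
    ∃ j, Does H j d (.recv k l.who m)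
  /-- a correct node makes progress: it does not remain forever in front of a waiting statement
  whose predicate holds continuously -/
  progress : ∀ p, ¬ Faulty H p → ∀ k,
    (∀ j, k ≤ j → CanReturn t w (configAt t v₀ H j) p) → ∃ j, k ≤ j ∧ Responds H j p

/-! ### Operations and atomicity. An operation is identified with the step that invokes it. -/

/-- Step `k` is the invocation of `write(v)` by `p`. -/
def IsWrite (H : Schedule n V) (k : ℕ) (p : Fin n) (v : V) : Prop := Does H k p (.invWrite v)

/-- Step `k` is the invocation of `read()` by `p`. -/
def IsRead (H : Schedule n V) (k : ℕ) (p : Fin n) : Prop :=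
  Does H k p .invRead ∨ Does H k p .invReadLocal

/-- Step `k` is the invocation of an operation by `p`. -/
def IsOp (H : Schedule n V) (k : ℕ) (p : Fin n) : Prop :=
  IsRead H k p ∨ ∃ v, IsWrite H k p v

/-- The operation of `p` invoked in step `k` returns in step `m`. -/
def ReturnsAt (H : Schedule n V) (k : ℕ) (p : Fin n) (m : ℕ) : Prop :=
  IsOp H k p ∧ k < m ∧ Responds H m p ∧ ∀ j, k < j → j < m → ¬ Responds H j p

/-- The operation invoked in step `k` terminated before the one invoked in step `k'` started. -/
def Precedes (H : Schedule n V) (k k' : ℕ) : Prop :=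
  ∃ p m, ReturnsAt H k p m ∧ m < k'

/-- Liveness: every operation invoked by a correct node terminates. -/
def Terminating (H : Schedule n V) : Prop :=
  ∀ k p, IsOp H k p → ¬ Faulty H p → ∃ m, ReturnsAt H k p m

/-- Consistency: all the operations that terminate, and possibly some that do not (each such
operation is the last one invoked by its node), can be arranged in a sequence (`pos k` is the
place of operation `k` in it) that respects the real-time order and in which each read returns the
value written by the closest preceding write, or `v₀` if there is none. -/
def Atomic (v₀ : V) (H : Schedule n V) : Prop :=
  ∃ (S : Set ℕ) (pos : ℕ → ℕ),
    (∀ k ∈ S, ∃ p, IsOp H k p) ∧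
    (∀ k p m, ReturnsAt H k p m → k ∈ S) ∧
    Set.InjOn pos S ∧
    (∀ k ∈ S, ∀ k' ∈ S, Precedes H k k' → pos k < pos k') ∧
    (∀ r ∈ S, ∀ p m v, IsRead H r p → ReturnsAt H r p m → Does H m p (.retRead v) →
      (v = v₀ ∧ ∀ k ∈ S, ∀ q u, IsWrite H k q u → pos r < pos k) ∨
      (∃ k ∈ S, ∃ q, IsWrite H k q v ∧ pos k < pos r ∧
        ∀ k' ∈ S, ∀ q' u, IsWrite H k' q' u → pos k' ≤ pos k ∨ pos r < pos k'))

/-! ### Time efficiency under the bounded-delay assumption -/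

/-- `time k` is the date of step `k`. Message delays are at most `Δ`: a message reaches its
destination within `Δ` unless the latter crashes. Local computation takes no time: time does not
advance while some node can return from its operation (message handlers are single steps). -/
structure BoundedDelay (t : ℕ) (w : Fin n) (v₀ : V) (H : Schedule n V)
    (time : ℕ → ℝ) (Δ : ℝ) : Prop where
  mono : Monotone time
  delay : ∀ k l, H k = some l → ∀ d m, (d, m) ∈ l.sent →
    ∃ j, time j ≤ time k + Δ ∧ (CrashesAt H j d ∨ Does H j d (.recv k l.who m))
  urgent : ∀ k p, CanReturn t w (configAt t v₀ H (k + 1)) p → time (k + 1) = time k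

/-- The operation of `p` invoked in step `k` ends in step `j` or has already ended:
`p` has returned from it, or has crashed. -/
def EndedBy (H : Schedule n V) (k : ℕ) (p : Fin n) (j : ℕ) : Prop :=
  ∃ i, k ≤ i ∧ i ≤ j ∧ (CrashesAt H i p ∨ (k < i ∧ Responds H i p))

/-- The operation of `p` invoked in step `k` takes at most `D` time units
(unless `p` crashes within that time). -/
def TakesAtMost (H : Schedule n V) (time : ℕ → ℝ) (k : ℕ) (p : Fin n) (D : ℝ) : Prop :=
  ∃ j, time j ≤ time k + D ∧ EndedBy H k p j

/-- `p` crashes while executing the operation it invoked in step `k`. -/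
def CrashesDuring (H : Schedule n V) (k : ℕ) (p : Fin n) : Prop :=
  ∃ i, k ≤ i ∧ CrashesAt H i p ∧ ∀ j, k < j → j ≤ i → ¬ Responds H j p

/-- The operations invoked in steps `k` by `p` and `k'` by `q` overlap: neither has ended when
the other one starts. -/
def Concurrent (H : Schedule n V) (k : ℕ) (p : Fin n) (k' : ℕ) (q : Fin n) : Prop :=
  ¬ EndedBy H k p k' ∧ ¬ EndedBy H k' q k

/-- The write invoked in step `k` is the last one that started before operation `r`. -/
def ClosestWrite (w : Fin n) (H : Schedule n V) (k r : ℕ) : Prop :=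
  k < r ∧ (∃ v, IsWrite H k w v) ∧ ∀ k' v, k' < r → IsWrite H k' w v → k' ≤ k

/-- The read `r` of `p` is write-latency-free: it is not concurrent with a write, and the closest
preceding write (if any) did not crash and started more than `Δ` before the read. -/
def WriteLatencyFree (w : Fin n) (H : Schedule n V) (time : ℕ → ℝ) (Δ : ℝ)
    (r : ℕ) (p : Fin n) : Prop :=
  (∀ k v, IsWrite H k w v → ¬ Concurrent H k w r p) ∧
  (∀ k, ClosestWrite w H k r → ¬ CrashesDuring H k w ∧ time k < time r - Δ)

/-- The write `k` interferes with the read `r` of `p`: it is the closest write preceding the read,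
or is concurrent with the read, and it started at time `≥ τ_r - Δ`. -/
def Interfering (w : Fin n) (H : Schedule n V) (time : ℕ → ℝ) (Δ : ℝ)
    (k r : ℕ) (p : Fin n) : Prop :=
  (ClosestWrite w H k r ∨ ((∃ v, IsWrite H k w v) ∧ Concurrent H k w r p)) ∧
  time r - Δ ≤ time k

/-- Time-efficiency of a timed run, in the bounded-delay sense. -/
structure TimeEfficient (w : Fin n) (H : Schedule n V) (time : ℕ → ℝ) (Δ : ℝ) : Prop where
  write : ∀ k v, IsWrite H k w v → TakesAtMost H time k w (2 * Δ)
  readFree : ∀ r p, IsRead H r p → WriteLatencyFree w H time Δ r p →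
    TakesAtMost H time r p (2 * Δ)
  readNoCrash : ∀ r p, IsRead H r p → ¬ WriteLatencyFree w H time Δ r p →
    (∀ k, Interfering w H time Δ k r p → ¬ CrashesDuring H k w) →
    TakesAtMost H time r p (3 * Δ)
  readCrash : ∀ r p, IsRead H r p → ¬ WriteLatencyFree w H time Δ r p →
    (∃ k, Interfering w H time Δ k r p ∧ CrashesDuring H k w) →
    TakesAtMost H time r p (4 * Δ)
  /-- each node experiences at most once a read that takes more than `3Δ` -/
  atMostOnce : ∀ r r' p, IsRead H r p → IsRead H r' p →
    ¬ TakesAtMost H time r p (3 * Δ) → ¬ TakesAtMost H time r' p (3 * Δ) → r = r'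

end SWMR

/-! Atomicity rests on quorum intersection. Each write carries the sequence number that the writer
gives it, and a read gets the value of `swsn` at its return (of `wsn`, for a local read of the
writer). When an operation with number x > 0 returns, some n - t nodes have `wsn` ≥ x
(`ReturnsAt.quorum`). A later ordinary read waits for answers to its own request from n - t nodes.
As 2t < n, one of them lies in the first quorum, answered after the return, and forces the later
`swsn` to be at least x; operations of the writer need no intersection, since the writer knows every
number in use. This is `ReturnsAt.retSeq_mono`. Ordering by number, with the write before the reads
of its value and those reads by invocation, therefore respects real time. Each operation has
finitely many predecessors (`IsRun.finite_opKey_lt`), so counting them gives a position in ℕ. An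
unfinished write is included exactly when its number is that of some terminated operation.

The time bounds rest on relaying. A broadcast to all nodes reaches the correct nodes within Δ; each
of them has by then relayed it, so within 2Δ every surviving node holds a quorum of acknowledgments
(`Broadcasts.quorum`). This settles writes. All answers to a read are sent within Δ, so the read
ends in time D ≥ 2Δ as soon as every number they may carry was fully broadcast 2Δ before the
deadline (`IsRun.read_takesAtMost`). Adopting a number and broadcasting it form a single step, so a
node alive after that step has sent the number to everybody: whatever an answer carries was
broadcast by τ_r + Δ, and every read takes at most 3Δ, even if the writer crashes. The 4Δ bound and
the "at most once" clause follow from this uniform bound. For a write-latency-free read the numbers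
were broadcast by the writer itself before the read, which gives 2Δ.

Liveness is the timed argument under the constant clock 0 with Δ = 0, for which every run has
bounded delays (`IsRun.boundedDelay_zero`). -/

namespace SWMR

variable {n : ℕ} {V : Type*}

/-! ### Local transitions -/

/-- The pair (sequence number, value) carried by a message that is handled as a `WRITE`. -/
def Msg.payload : Msg V → Option (ℕ × V)
  | .write x v => some (x, v)
  | .read _ => none
  | .state _ x v => some (x, v)

section Local

variable (t : ℕ) (s : LState n V) (src : Fin n) (x : ℕ) (v : V)

theorem LState.onWrite_wsn : (s.onWrite t src x v).wsn = max s.wsn x := by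
  unfold LState.onWrite
  dsimp only
  split_ifs <;> simp <;> omega

theorem LState.onWrite_reg :
    (s.onWrite t src x v).reg = if s.wsn < x then v else s.reg := by
  unfold LState.onWrite
  dsimp only
  split_ifs <;> simp

theorem LState.onWrite_acks :
    (s.onWrite t src x v).acks = Function.update s.acks x (insert src (s.acks x)) := by
  unfold LState.onWrite
  dsimp only
  split_ifs <;> simp

theorem LState.onWrite_done : (s.onWrite t src x v).done = insert x s.done := by
  unfold LState.onWrite
  dsimp only
  split_ifs <;> simp

theorem LState.onWrite_rsn : (s.onWrite t src x v).rsn = s.rsn := by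
  unfold LState.onWrite
  dsimp only
  split_ifs <;> simp

theorem LState.onWrite_client : (s.onWrite t src x v).client = s.client := by
  unfold LState.onWrite
  dsimp only
  split_ifs <;> simp

theorem LState.onWrite_reports : (s.onWrite t src x v).reports = s.reports := by
  unfold LState.onWrite
  dsimp only
  split_ifs <;> simp

/-- The last clause of the second case is the failed test, contraposed. The first case shows that
`swsn` always has a quorum behind it, the second that a quorum always raises `swsn`. -/
theorem LState.onWrite_swsn_res :
    ((s.onWrite t src x v).swsn = x ∧ (s.onWrite t src x v).res = v ∧ s.swsn < x ∧
        n - t ≤ (insert src (s.acks x)).card) ∨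
      ((s.onWrite t src x v).swsn = s.swsn ∧ (s.onWrite t src x v).res = s.res ∧
        (n - t ≤ (insert src (s.acks x)).card → x ≤ s.swsn)) := by
  unfold LState.onWrite
  dsimp only
  split_ifs with h1 h2 h2
  · left; simp_all
  · right; simp_all
  · left; simp_all
  · right; simp_all

variable {t s src x v}

theorem LState.onRecv_of_payload_none {m : Msg V} (hm : m.payload = none) :
    s.onRecv t src m = s := by
  cases m <;> simp_all [Msg.payload, LState.onRecv]

/-- A `STATE` differs from the `WRITE` it contains only in `reports`; leaving that field unspecified
lets both be treated together. -/
theorem LState.onRecv_of_payload_some {m : Msg V} (hm : m.payload = some (x, v)) :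
    ∃ rep, s.onRecv t src m = { s.onWrite t src x v with reports := rep } := by
  cases m with
  | write y u =>
    simp only [Msg.payload, Option.some.injEq, Prod.mk.injEq] at hm
    obtain ⟨rfl, rfl⟩ := hm
    exact ⟨_, rfl⟩
  | read r => simp [Msg.payload] at hm
  | state r y u =>
    simp only [Msg.payload, Option.some.injEq, Prod.mk.injEq] at hm
    obtain ⟨rfl, rfl⟩ := hm
    exact ⟨_, rfl⟩

theorem LState.wsn_le_after (e : Event n V) : s.wsn ≤ (s.after t e).wsn := by
  cases e with
  | recv k src m =>
    rcases hm : m.payload with _ | ⟨x, v⟩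
    · simp [LState.after, LState.onRecv_of_payload_none hm]
    · obtain ⟨rep, h⟩ := LState.onRecv_of_payload_some (t := t) (s := s) (src := src) hm
      simp [LState.after, h, LState.onWrite_wsn]
  | _ => simp [LState.after]

theorem LState.rsn_le_after (e : Event n V) : s.rsn ≤ (s.after t e).rsn := by
  cases e with
  | recv k src m =>
    rcases hm : m.payload with _ | ⟨x, v⟩
    · simp [LState.after, LState.onRecv_of_payload_none hm]
    · obtain ⟨rep, h⟩ := LState.onRecv_of_payload_some (t := t) (s := s) (src := src) hm
      simp [LState.after, h, LState.onWrite_rsn]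
  | _ => simp [LState.after]

theorem LState.acks_subset_after (e : Event n V) (y : ℕ) :
    s.acks y ⊆ (s.after t e).acks y := by
  cases e with
  | recv k src m =>
    rcases hm : m.payload with _ | ⟨x, v⟩
    · simp [LState.after, LState.onRecv_of_payload_none hm]
    · obtain ⟨rep, h⟩ := LState.onRecv_of_payload_some (t := t) (s := s) (src := src) hm
      simp only [LState.after, h, LState.onWrite_acks]
      by_cases hy : y = x
      · subst hy; simp
      · simp [hy]
  | _ => simp [LState.after]

theorem LState.reports_subset_after (e : Event n V) (r : ℕ) :
    s.reports r ⊆ (s.after t e).reports r := by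
  cases e with
  | recv k src m =>
    cases m with
    | write y u => simp [LState.after, LState.onRecv, LState.onWrite_reports]
    | read r' => simp [LState.after, LState.onRecv]
    | state r' y u =>
      simp only [LState.after, LState.onRecv, LState.onWrite_reports]
      by_cases hy : r = r'
      · subst hy; simp
      · simp [hy]
  | _ => simp [LState.after]

theorem LState.mem_reports_after {e : Event n V} {r : ℕ} {q : Fin n}
    (h : (q, x) ∈ (s.after t e).reports r) :
    (q, x) ∈ s.reports r ∨ ∃ k v, e = .recv k q (.state r x v) := by
  cases e with
  | recv k src m =>
    cases m with
    | write y u => left; simpa [LState.after, LState.onRecv, LState.onWrite_reports] using h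
    | read r' => left; simpa [LState.after, LState.onRecv] using h
    | state r' y u =>
      simp only [LState.after, LState.onRecv, LState.onWrite_reports] at h
      by_cases hy : r = r'
      · subst hy
        simp only [Function.update_self, Finset.mem_insert, Prod.mk.injEq] at h
        rcases h with ⟨rfl, rfl⟩ | h
        · exact Or.inr ⟨k, u, rfl⟩
        · exact Or.inl h
      · left; simpa [hy] using h
  | _ => left; simpa [LState.after] using h

end Local

/-! ### Steps of a run -/

/-- The local state of node `p` before step number `j`. -/
abbrev nodeAt (t : ℕ) (v₀ : V) (H : Schedule n V) (j : ℕ) (p : Fin n) : LState n V :=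
  (configAt t v₀ H j).node p

variable {t : ℕ} {w : Fin n} {v₀ : V} {H : Schedule n V}

theorem Does.unique {k : ℕ} {p q : Fin n} {e f : Event n V} (h : Does H k p e)
    (h' : Does H k q f) : p = q ∧ e = f := by
  obtain ⟨l, hl, rfl, rfl⟩ := h
  obtain ⟨l', hl', rfl, rfl⟩ := h'
  rw [hl] at hl'
  cases hl'
  exact ⟨rfl, rfl⟩

theorem configAt_succ_some {k : ℕ} {l : Label n V} (h : H k = some l) :
    configAt t v₀ H (k + 1) = (configAt t v₀ H k).next t k l := by
  simp [configAt, h]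

theorem configAt_succ_none {k : ℕ} (h : H k = none) :
    configAt t v₀ H (k + 1) = configAt t v₀ H k := by
  simp [configAt, h]

theorem node_succ_of_step {k : ℕ} {l : Label n V} (h : H k = some l) :
    nodeAt t v₀ H (k + 1) l.who =
      { (nodeAt t v₀ H k l.who).after t l.event with crashed := l.crash } := by
  simp [nodeAt, configAt_succ_some h, Config.next]

theorem node_succ_cases (k : ℕ) (p : Fin n) :
    (∃ l, H k = some l ∧ l.who = p ∧ nodeAt t v₀ H (k + 1) p =
      { (nodeAt t v₀ H k p).after t l.event with crashed := l.crash }) ∨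
    ((∀ e, ¬ Does H k p e) ∧ nodeAt t v₀ H (k + 1) p = nodeAt t v₀ H k p) := by
  rcases hk : H k with _ | l
  · right
    refine ⟨fun e ⟨l, hl, _⟩ => by simp [hk] at hl, ?_⟩
    simp [nodeAt, configAt_succ_none hk]
  · by_cases hp : l.who = p
    · left
      subst hp
      exact ⟨l, rfl, rfl, node_succ_of_step hk⟩
    · right
      refine ⟨fun e ⟨l', hl, hp', _⟩ => ?_, ?_⟩
      · rw [hk] at hl; cases hl; exact hp hp'
      · simp [nodeAt, configAt_succ_some hk, Config.next, Function.update_of_ne (Ne.symm hp)]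

theorem mem_transit_succ {k : ℕ} {pk : Packet n V}
    (h : pk ∈ (configAt t v₀ H (k + 1)).transit) :
    (pk ∈ (configAt t v₀ H k).transit ∧
      ∀ l, H k = some l → pk ∉ consumed l.who l.event) ∨
    ∃ l, H k = some l ∧ pk.sentAt = k ∧ pk.src = l.who ∧ (pk.dst, pk.msg) ∈ l.sent := by
  rcases hk : H k with _ | l
  · left
    rw [configAt_succ_none hk] at h
    exact ⟨h, by simp⟩
  · rw [configAt_succ_some hk] at h
    rcases h with h | h
    · left
      refine ⟨h.1, ?_⟩
      rintro l' ⟨⟩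
      exact h.2
    · exact Or.inr ⟨l, rfl, h⟩

theorem sent_of_mem_transit {j : ℕ} {pk : Packet n V} (h : pk ∈ (configAt t v₀ H j).transit) :
    pk.sentAt < j ∧
      ∃ l, H pk.sentAt = some l ∧ l.who = pk.src ∧ (pk.dst, pk.msg) ∈ l.sent := by
  induction j with
  | zero => simp [configAt] at h
  | succ j ih =>
    rcases mem_transit_succ h with h | ⟨l, hl, h1, h2, h3⟩
    · obtain ⟨h1, h2⟩ := ih h.1
      exact ⟨by omega, h2⟩
    · subst h1
      exact ⟨by omega, l, hl, h2.symm, h3⟩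

/-- A packet is stamped with its sending step `k`, so no step after `k` can put the same packet back
in transit. -/
theorem not_mem_transit_of_received {j k i : ℕ} {q p : Fin n} {m : Msg V}
    (h : Does H j q (.recv k p m)) (hk : k < j) (hi : j < i) :
    (⟨k, p, q, m⟩ : Packet n V) ∉ (configAt t v₀ H i).transit := by
  induction i, hi using Nat.le_induction with
  | base =>
    intro hm
    obtain ⟨l, hl, rfl, he⟩ := h
    rcases mem_transit_succ hm with hm | ⟨l', hl', h1, -⟩
    · exact hm.2 l hl (by rw [he]; rfl)
    · simp at h1; omega
  | succ i hi ih =>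
    intro hm
    rcases mem_transit_succ hm with hm | ⟨l', hl', h1, -⟩
    · exact ih hm.1
    · simp at h1; omega

theorem IsRun.alive (hH : IsRun t w v₀ H) {k : ℕ} {p : Fin n} {e : Event n V}
    (h : Does H k p e) : (nodeAt t v₀ H k p).crashed = false := by
  obtain ⟨l, hl, rfl, rfl⟩ := h
  exact (hH.allowed k l hl).1

theorem IsRun.guard (hH : IsRun t w v₀ H) {k : ℕ} {p : Fin n} {e : Event n V}
    (h : Does H k p e) : Guard t w (configAt t v₀ H k) p e := by
  obtain ⟨l, hl, rfl, rfl⟩ := h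
  exact (hH.allowed k l hl).2.1

/-- Every received message was sent in an earlier step. -/
theorem IsRun.sent_of_recv (hH : IsRun t w v₀ H) {j k : ℕ} {p q : Fin n} {m : Msg V}
    (h : Does H j p (.recv k q m)) :
    k < j ∧ ∃ l, H k = some l ∧ l.who = q ∧ (p, m) ∈ l.sent :=
  sent_of_mem_transit (hH.guard h)

/-- A packet is received at most once. -/
theorem IsRun.recv_le (hH : IsRun t w v₀ H) {i j k : ℕ} {p q : Fin n} {m : Msg V}
    (h : Does H j p (.recv k q m)) (h' : Does H i p (.recv k q m)) : i ≤ j := by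
  by_contra hij
  exact not_mem_transit_of_received h (hH.sent_of_recv h).1 (not_le.1 hij) (hH.guard h')

theorem IsRun.sent_mem_out (hH : IsRun t w v₀ H) {k : ℕ} {l : Label n V} (h : H k = some l)
    {d : Fin n} {m : Msg V} (hm : (d, m) ∈ l.sent) :
    (d, m) ∈ (nodeAt t v₀ H k l.who).out l.event :=
  (hH.allowed k l h).2.2.2.1 hm

/-- The flag is overwritten at every step of the node; it stays set because a crashed node takes no
further step. -/
theorem IsRun.crashed_iff (hH : IsRun t w v₀ H) (j : ℕ) (p : Fin n) :
    (nodeAt t v₀ H j p).crashed = true ↔ ∃ i < j, CrashesAt H i p := by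
  induction j with
  | zero => simp [nodeAt, configAt, LState.start]
  | succ j ih =>
    rcases node_succ_cases (t := t) (v₀ := v₀) (H := H) j p with ⟨l, hl, hp, h⟩ | ⟨hno, h⟩
    · rw [h]
      have halive := hH.alive (k := j) (p := p) ⟨l, hl, hp, rfl⟩
      constructor
      · intro hc
        exact ⟨j, by omega, l, hl, hp, hc⟩
      · rintro ⟨i, hi, hc⟩
        rcases Nat.lt_succ_iff_lt_or_eq.1 hi with hi | rfl
        · rw [ih.2 ⟨i, hi, hc⟩] at halive
          simp at halive
        · obtain ⟨l', hl', -, hc⟩ := hc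
          rw [hl] at hl'
          cases hl'
          exact hc
    · rw [h, ih]
      constructor
      · rintro ⟨i, hi, hc⟩; exact ⟨i, by omega, hc⟩
      · rintro ⟨i, hi, hc⟩
        rcases Nat.lt_succ_iff_lt_or_eq.1 hi with hi | rfl
        · exact ⟨i, hi, hc⟩
        · obtain ⟨l, hl, hp, -⟩ := hc
          exact absurd ⟨l, hl, hp, rfl⟩ (hno l.event)

theorem IsRun.not_crashesAt_of_does (hH : IsRun t w v₀ H) {i k : ℕ} {p : Fin n} {e : Event n V}
    (h : Does H k p e) (hi : i < k) : ¬ CrashesAt H i p := by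
  intro hc
  have := (hH.crashed_iff k p).2 ⟨i, hi, hc⟩
  rw [hH.alive h] at this
  simp at this

/-! ### Monotonicity -/

theorem monotone_of_after {β : Type*} [Preorder β] (f : LState n V → β)
    (hf : ∀ s : LState n V, ∀ b, f { s with crashed := b } = f s)
    (ha : ∀ (s : LState n V) e, f s ≤ f (s.after t e)) (p : Fin n) :
    Monotone fun j => f (nodeAt t v₀ H j p) := by
  refine monotone_nat_of_le_succ fun j => ?_
  rcases node_succ_cases (t := t) (v₀ := v₀) (H := H) j p with ⟨l, -, -, h⟩ | ⟨-, h⟩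
  · rw [h]; exact (ha _ l.event).trans_eq (hf _ l.crash).symm
  · rw [h]

theorem wsn_mono (p : Fin n) : Monotone fun j => (nodeAt t v₀ H j p).wsn :=
  monotone_of_after (fun s => s.wsn) (fun _ _ => rfl) (fun _ e => LState.wsn_le_after e) p

theorem rsn_mono (p : Fin n) : Monotone fun j => (nodeAt t v₀ H j p).rsn :=
  monotone_of_after (fun s => s.rsn) (fun _ _ => rfl) (fun _ e => LState.rsn_le_after e) p

theorem acks_mono (p : Fin n) (x : ℕ) : Monotone fun j => (nodeAt t v₀ H j p).acks x :=
  monotone_of_after (fun s => s.acks x) (fun _ _ => rfl)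
    (fun _ e => LState.acks_subset_after e x) p

theorem reports_mono (p : Fin n) (r : ℕ) : Monotone fun j => (nodeAt t v₀ H j p).reports r :=
  monotone_of_after (fun s => s.reports r) (fun _ _ => rfl)
    (fun _ e => LState.reports_subset_after e r) p

/-! ### Invariants of runs -/

/-- The two states agree on everything that concerns the propagation of writes. -/
structure SameCore (s s' : LState n V) : Prop where
  wsn : s'.wsn = s.wsn
  reg : s'.reg = s.reg
  swsn : s'.swsn = s.swsn
  res : s'.res = s.res
  acks : s'.acks = s.acks
  done : s'.done = s.done

theorem node_succ_of_does {j : ℕ} {p : Fin n} {e : Event n V} (h : Does H j p e) :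
    ∃ b, nodeAt t v₀ H (j + 1) p = { (nodeAt t v₀ H j p).after t e with crashed := b } := by
  obtain ⟨l, hl, rfl, rfl⟩ := h
  exact ⟨l.crash, node_succ_of_step hl⟩

theorem node_succ_of_payload {j k : ℕ} {p q : Fin n} {m : Msg V} {x : ℕ} {v : V}
    (h : Does H j p (.recv k q m)) (hm : m.payload = some (x, v)) :
    ∃ rep b, nodeAt t v₀ H (j + 1) p =
      { (nodeAt t v₀ H j p).onWrite t q x v with reports := rep, crashed := b } := by
  obtain ⟨b, hb⟩ := node_succ_of_does (t := t) (v₀ := v₀) h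
  obtain ⟨rep, hr⟩ := LState.onRecv_of_payload_some (t := t) (s := nodeAt t v₀ H j p)
    (src := q) hm
  refine ⟨rep, b, ?_⟩
  rw [hb]
  simp only [LState.after, hr]

/-- A step either does not affect the propagation of writes at `p`, or is the invocation of a
write by `p`, or the reception by `p` of a message that is handled as a `WRITE`. -/
theorem IsRun.core_cases (hH : IsRun t w v₀ H) (j : ℕ) (p : Fin n) :
    SameCore (nodeAt t v₀ H j p) (nodeAt t v₀ H (j + 1) p) ∨
    (∃ v, Does H j p (.invWrite v) ∧ p = w) ∨
    (∃ k q m x v, Does H j p (.recv k q m) ∧ m.payload = some (x, v)) := by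
  rcases node_succ_cases (t := t) (v₀ := v₀) (H := H) j p with ⟨l, hl, hp, h⟩ | ⟨-, h⟩
  · have hd : Does H j p l.event := ⟨l, hl, hp, rfl⟩
    rw [h]
    generalize l.event = e at hd
    cases e with
    | invWrite v => exact Or.inr (Or.inl ⟨v, hd, (hH.guard hd).1⟩)
    | recv k q m =>
      rcases hm : m.payload with _ | ⟨x, v⟩
      · left
        simp only [LState.after, LState.onRecv_of_payload_none hm]
        constructor <;> rfl
      · exact Or.inr (Or.inr ⟨k, q, m, x, v, hd, hm⟩)
    | _ => left; constructor <;> rfl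
  · left
    rw [h]
    constructor <;> rfl

theorem wsn_succ_of_invWrite {j : ℕ} {p : Fin n} {v : V} (h : Does H j p (.invWrite v)) :
    (nodeAt t v₀ H (j + 1) p).wsn = (nodeAt t v₀ H j p).wsn + 1 := by
  obtain ⟨b, hb⟩ := node_succ_of_does (t := t) (v₀ := v₀) h
  rw [hb]
  rfl

theorem wsn_succ_of_payload {j k : ℕ} {p q : Fin n} {m : Msg V} {x : ℕ} {v : V}
    (h : Does H j p (.recv k q m)) (hm : m.payload = some (x, v)) :
    (nodeAt t v₀ H (j + 1) p).wsn = max (nodeAt t v₀ H j p).wsn x := by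
  obtain ⟨rep, b, hb⟩ := node_succ_of_payload (t := t) (v₀ := v₀) h hm
  rw [hb]
  simp only [LState.onWrite_wsn]

theorem acks_succ_of_payload {j k : ℕ} {p q : Fin n} {m : Msg V} {x : ℕ} {v : V}
    (h : Does H j p (.recv k q m)) (hm : m.payload = some (x, v)) :
    (nodeAt t v₀ H (j + 1) p).acks = Function.update (nodeAt t v₀ H j p).acks x
      (insert q ((nodeAt t v₀ H j p).acks x)) := by
  obtain ⟨rep, b, hb⟩ := node_succ_of_payload (t := t) (v₀ := v₀) h hm
  rw [hb]
  simp only [LState.onWrite_acks]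

theorem done_succ_of_payload {j k : ℕ} {p q : Fin n} {m : Msg V} {x : ℕ} {v : V}
    (h : Does H j p (.recv k q m)) (hm : m.payload = some (x, v)) :
    (nodeAt t v₀ H (j + 1) p).done = insert x (nodeAt t v₀ H j p).done := by
  obtain ⟨rep, b, hb⟩ := node_succ_of_payload (t := t) (v₀ := v₀) h hm
  rw [hb]
  simp only [LState.onWrite_done]

/-- Origin of the messages that are handled as a `WRITE`. -/
theorem IsRun.payload_sent_cases (hH : IsRun t w v₀ H) {k : ℕ} {l : Label n V} (h : H k = some l)
    {d : Fin n} {m : Msg V} (hm : (d, m) ∈ l.sent) {x : ℕ} {v : V}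
    (hx : m.payload = some (x, v)) :
    (Does H k l.who (.invWrite v) ∧ l.who = w ∧ x = (nodeAt t v₀ H k l.who).wsn + 1) ∨
    (∃ k' q m', Does H k l.who (.recv k' q m') ∧ m'.payload = some (x, v)) ∨
    (∃ k' r, Does H k l.who (.recv k' d (.read r)) ∧ m = .state r x v ∧
      x = (nodeAt t v₀ H k l.who).wsn ∧ v = (nodeAt t v₀ H k l.who).reg) := by
  have ho := hH.sent_mem_out h hm
  have hd : Does H k l.who l.event := ⟨l, h, rfl, rfl⟩
  generalize l.event = e at ho hd
  cases e with
  | invWrite u =>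
    simp only [LState.out, bcast, Set.mem_ofPred_eq] at ho
    subst ho
    simp only [Msg.payload, Option.some.injEq, Prod.mk.injEq] at hx
    obtain ⟨rfl, rfl⟩ := hx
    exact Or.inl ⟨hd, (hH.guard hd).1, rfl⟩
  | invRead =>
    simp only [LState.out, bcast, Set.mem_ofPred_eq] at ho
    subst ho
    simp [Msg.payload] at hx
  | recv k' q m' =>
    right
    have key : ∀ y u, (d, m) ∈ (nodeAt t v₀ H k l.who).onWriteOut y u → y = x ∧ u = v := by
      intro y u hyu
      unfold LState.onWriteOut at hyu
      split_ifs at hyu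
      · simp only [bcast, Set.mem_ofPred_eq] at hyu
        subst hyu
        simpa [Msg.payload] using hx
      · simp at hyu
    cases m' with
    | write y u =>
      left
      obtain ⟨rfl, rfl⟩ := key y u ho
      exact ⟨k', q, _, hd, rfl⟩
    | state r y u =>
      left
      obtain ⟨rfl, rfl⟩ := key y u ho
      exact ⟨k', q, _, hd, rfl⟩
    | read r =>
      right
      simp only [LState.out, LState.onRecvOut, Set.mem_singleton_iff, Prod.mk.injEq] at ho
      obtain ⟨rfl, rfl⟩ := ho
      simp only [Msg.payload, Option.some.injEq, Prod.mk.injEq] at hx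
      exact ⟨k', r, hd, by simp [hx.1, hx.2], hx.1.symm, hx.2.symm⟩
  | _ => simp [LState.out] at ho

/-- The number is compared with the state after step `k`, because invoking a write and relaying one
adopt the number in the step that sends it. -/
theorem IsRun.payload_le_wsn (hH : IsRun t w v₀ H) {k : ℕ} {l : Label n V} (h : H k = some l)
    {d : Fin n} {m : Msg V} (hm : (d, m) ∈ l.sent) {x : ℕ} {v : V}
    (hx : m.payload = some (x, v)) : x ≤ (nodeAt t v₀ H (k + 1) l.who).wsn := by
  rcases hH.payload_sent_cases h hm hx with ⟨h1, -, h3⟩ | ⟨k', q, m', h1, h2⟩ | ⟨k', r, -, -, h3, -⟩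
  · rw [wsn_succ_of_invWrite h1, h3]
  · rw [wsn_succ_of_payload h1 h2]
    exact le_max_right _ _
  · rw [h3]
    exact wsn_mono l.who (Nat.le_succ k)

/-- A message handled as `WRITE(x,-)` that has been received from `q` shows that `q` has reached
the sequence number `x`. -/
theorem IsRun.payload_le_wsn_of_recv (hH : IsRun t w v₀ H) {j k : ℕ} {p q : Fin n} {m : Msg V}
    (h : Does H j p (.recv k q m)) {x : ℕ} {v : V} (hx : m.payload = some (x, v)) :
    x ≤ (nodeAt t v₀ H j q).wsn := by
  obtain ⟨hk, l, hl, rfl, hm⟩ := hH.sent_of_recv h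
  exact (hH.payload_le_wsn hl hm hx).trans (wsn_mono l.who hk)

/-- Turns a quorum of acknowledgments into a quorum of nodes that know the number, which is one half
of the quorum intersection argument. -/
theorem IsRun.le_wsn_of_mem_acks (hH : IsRun t w v₀ H) {j x : ℕ} {p q : Fin n}
    (h : q ∈ (nodeAt t v₀ H j p).acks x) : x ≤ (nodeAt t v₀ H j q).wsn := by
  induction j with
  | zero => simp [nodeAt, configAt, LState.start] at h
  | succ j ih =>
    have hmono := wsn_mono (t := t) (v₀ := v₀) (H := H) q (Nat.le_succ j)
    rcases hH.core_cases j p with hc | ⟨v, hd, -⟩ | ⟨k, q', m, y, v, hd, hm⟩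
    · rw [hc.acks] at h
      exact (ih h).trans hmono
    · obtain ⟨b, hb⟩ := node_succ_of_does (t := t) (v₀ := v₀) hd
      rw [hb] at h
      exact (ih h).trans hmono
    · rw [acks_succ_of_payload hd hm] at h
      by_cases hy : x = y
      · subst hy
        simp only [Function.update_self, Finset.mem_insert] at h
        rcases h with rfl | h
        · exact (hH.payload_le_wsn_of_recv hd hm).trans hmono
        · exact (ih h).trans hmono
      · rw [Function.update_of_ne hy] at h
        exact (ih h).trans hmono

/-- The writer knows the greatest sequence number. -/
theorem IsRun.wsn_le_writer (hH : IsRun t w v₀ H) (j : ℕ) (p : Fin n) :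
    (nodeAt t v₀ H j p).wsn ≤ (nodeAt t v₀ H j w).wsn := by
  induction j generalizing p with
  | zero => simp [nodeAt, configAt, LState.start]
  | succ j ih =>
    have hmono := wsn_mono (t := t) (v₀ := v₀) (H := H) w (Nat.le_succ j)
    rcases hH.core_cases j p with hc | ⟨v, hd, rfl⟩ | ⟨k, q', m, y, v, hd, hm⟩
    · rw [hc.wsn]
      exact (ih p).trans hmono
    · exact le_rfl
    · rw [wsn_succ_of_payload hd hm]
      exact max_le ((ih p).trans hmono)
        ((hH.payload_le_wsn_of_recv hd hm).trans ((ih q').trans hmono))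

/-- No message carries a number beyond the writer's own, so receptions leave the writer's counter
alone and only its invocations raise it. -/
theorem IsRun.writer_wsn_succ (hH : IsRun t w v₀ H) {j : ℕ}
    (h : ∀ v, ¬ Does H j w (.invWrite v)) :
    (nodeAt t v₀ H (j + 1) w).wsn = (nodeAt t v₀ H j w).wsn := by
  rcases hH.core_cases j w with hc | ⟨v, hd, -⟩ | ⟨k, q', m, y, v, hd, hm⟩
  · exact hc.wsn
  · exact absurd hd (h v)
  · rw [wsn_succ_of_payload hd hm]
    exact max_eq_left ((hH.payload_le_wsn_of_recv hd hm).trans (hH.wsn_le_writer j q'))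

theorem IsRun.quorum_swsn (hH : IsRun t w v₀ H) (j : ℕ) (p : Fin n) :
    (nodeAt t v₀ H j p).swsn = 0 ∨
      n - t ≤ ((nodeAt t v₀ H j p).acks (nodeAt t v₀ H j p).swsn).card := by
  induction j with
  | zero => simp [nodeAt, configAt, LState.start]
  | succ j ih =>
    rcases hH.core_cases j p with hc | ⟨v, hd, rfl⟩ | ⟨k, q', m, y, v, hd, hm⟩
    · rw [hc.swsn, hc.acks]
      exact ih
    · obtain ⟨b, hb⟩ := node_succ_of_does (t := t) (v₀ := v₀) hd
      rw [hb]
      exact ih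
    · have hmono := acks_mono (t := t) (v₀ := v₀) (H := H) p
        (nodeAt t v₀ H (j + 1) p).swsn (Nat.le_succ j)
      have hacks := acks_succ_of_payload (t := t) (v₀ := v₀) hd hm
      obtain ⟨rep, b, hb⟩ := node_succ_of_payload (t := t) (v₀ := v₀) hd hm
      have hs : (nodeAt t v₀ H (j + 1) p).swsn =
          ((nodeAt t v₀ H j p).onWrite t q' y v).swsn := by rw [hb]
      rcases LState.onWrite_swsn_res t (nodeAt t v₀ H j p) q' y v with
        ⟨h1, -, -, h4⟩ | ⟨h1, -, -⟩
      · right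
        rw [hs, h1, hacks]
        simpa using h4
      · rw [hs, h1] at hmono ⊢
        exact ih.imp id fun h => h.trans (Finset.card_le_card hmono)

/-- With `quorum_swsn`, this makes `swsn` the greatest number acknowledged by a quorum. The
hypothesis `t < n` prevents the empty set from being a quorum in the initial state. -/
theorem IsRun.le_swsn_of_quorum (hH : IsRun t w v₀ H) (htn : t < n) {j : ℕ} {p : Fin n} {x : ℕ}
    (h : n - t ≤ ((nodeAt t v₀ H j p).acks x).card) : x ≤ (nodeAt t v₀ H j p).swsn := by
  induction j with
  | zero =>
    simp [nodeAt, configAt, LState.start] at h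
    omega
  | succ j ih =>
    rcases hH.core_cases j p with hc | ⟨v, hd, rfl⟩ | ⟨k, q', m, y, v, hd, hm⟩
    · rw [hc.swsn]
      rw [hc.acks] at h
      exact ih h
    · obtain ⟨b, hb⟩ := node_succ_of_does (t := t) (v₀ := v₀) hd
      rw [hb] at h ⊢
      exact ih h
    · rw [acks_succ_of_payload hd hm] at h
      obtain ⟨rep, b, hb⟩ := node_succ_of_payload (t := t) (v₀ := v₀) hd hm
      have hs : (nodeAt t v₀ H (j + 1) p).swsn =
          ((nodeAt t v₀ H j p).onWrite t q' y v).swsn := by rw [hb]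
      rw [hs]
      by_cases hy : x = y
      · subst hy
        rw [Function.update_self] at h
        rcases LState.onWrite_swsn_res t (nodeAt t v₀ H j p) q' x v with
          ⟨h1, -, -, -⟩ | ⟨h1, -, h3⟩
        · exact h1.ge
        · rw [h1]
          exact h3 h
      · rw [Function.update_of_ne hy] at h
        rcases LState.onWrite_swsn_res t (nodeAt t v₀ H j p) q' y v with
          ⟨h1, -, h3, -⟩ | ⟨h1, -, -⟩
        · rw [h1]
          exact (ih h).trans h3.le
        · rw [h1]
          exact ih h

theorem IsRun.swsn_le_writer (hH : IsRun t w v₀ H) (htn : t < n) (j : ℕ) (p : Fin n) :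
    (nodeAt t v₀ H j p).swsn ≤ (nodeAt t v₀ H j w).wsn := by
  rcases hH.quorum_swsn j p with h | h
  · omega
  · obtain ⟨q, hq⟩ := Finset.card_pos.1 (lt_of_lt_of_le (by omega) h)
    exact (hH.le_wsn_of_mem_acks hq).trans (hH.wsn_le_writer j q)

/-- The last write has been acknowledged by a quorum when the writer is not writing. -/
theorem IsRun.quorum_writer (hH : IsRun t w v₀ H) (j : ℕ)
    (h : (nodeAt t v₀ H j w).client ≠ .writing) :
    (nodeAt t v₀ H j w).wsn = 0 ∨
      n - t ≤ ((nodeAt t v₀ H j w).acks (nodeAt t v₀ H j w).wsn).card := by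
  induction j with
  | zero => simp [nodeAt, configAt, LState.start]
  | succ j ih =>
    by_cases hinv : ∃ v, Does H j w (.invWrite v)
    · obtain ⟨v, hd⟩ := hinv
      obtain ⟨b, hb⟩ := node_succ_of_does (t := t) (v₀ := v₀) hd
      rw [hb] at h
      exact absurd rfl h
    push Not at hinv
    have hmono := acks_mono (t := t) (v₀ := v₀) (H := H) w
        (nodeAt t v₀ H j w).wsn (Nat.le_succ j)
    rw [hH.writer_wsn_succ hinv]
    -- The writer can leave the waiting state of a write only through `retWrite`, whose guard is the
    -- quorum itself.
    have hprev : (nodeAt t v₀ H j w).client ≠ .writing ∨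
        (nodeAt t v₀ H j w).writeReady t := by
      rcases node_succ_cases (t := t) (v₀ := v₀) (H := H) j w with ⟨l, hl, hp, hn⟩ | ⟨-, hn⟩
      · have hd : Does H j w l.event := ⟨l, hl, hp, rfl⟩
        rw [hn] at h
        generalize l.event = e at hd h
        have hg := hH.guard hd
        cases e with
        | invWrite v => exact absurd hd (hinv v)
        | recv k q m =>
          left
          rcases hm : m.payload with _ | ⟨x, v⟩
          · simpa [LState.after, LState.onRecv_of_payload_none hm] using h
          · obtain ⟨rep, h'⟩ := LState.onRecv_of_payload_some (t := t)
              (s := nodeAt t v₀ H j w) (src := q) hm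
            simpa [LState.after, h', LState.onWrite_client] using h
        | retWrite => exact Or.inr hg.2
        | invRead => left; rw [show (nodeAt t v₀ H j w).client = _ from hg]; simp
        | invReadLocal => left; rw [show (nodeAt t v₀ H j w).client = _ from hg.2]; simp
        | retRead v =>
          left
          rcases hg with hg | hg
          · rw [show (nodeAt t v₀ H j w).client = _ from hg.1]; simp
          · rw [show (nodeAt t v₀ H j w).client = _ from hg.1]; simp
        | halt => left; exact h
      · left; rwa [hn] at h
    rcases hprev with hp | hp
    · exact (ih hp).imp id fun h => h.trans (Finset.card_le_card hmono)
    · exact Or.inr (le_trans hp (Finset.card_le_card hmono))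

/-- `v` is the value with sequence number `x`. -/
def IsVal (t : ℕ) (w : Fin n) (v₀ : V) (H : Schedule n V) (x : ℕ) (v : V) : Prop :=
  (x = 0 ∧ v = v₀) ∨ ∃ k, IsWrite H k w v ∧ (nodeAt t v₀ H k w).wsn + 1 = x

/-- States and sent messages are treated in one induction: states take their pairs from messages,
and messages take theirs from states. -/
theorem IsRun.isVal (hH : IsRun t w v₀ H) (j : ℕ) :
    (∀ p, IsVal t w v₀ H (nodeAt t v₀ H j p).wsn (nodeAt t v₀ H j p).reg ∧
      IsVal t w v₀ H (nodeAt t v₀ H j p).swsn (nodeAt t v₀ H j p).res) ∧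
    ∀ k < j, ∀ l, H k = some l → ∀ d m x v, (d, m) ∈ l.sent → m.payload = some (x, v) →
      IsVal t w v₀ H x v := by
  induction j with
  | zero => exact ⟨fun p => ⟨Or.inl ⟨rfl, rfl⟩, Or.inl ⟨rfl, rfl⟩⟩, by simp⟩
  | succ j ih =>
    obtain ⟨ih1, ih2⟩ := ih
    have hrecv : ∀ {k p q m x v}, Does H j p (.recv k q m) → m.payload = some (x, v) →
        IsVal t w v₀ H x v := by
      intro k p q m x v hd hm
      obtain ⟨hk, l, hl, -, hs⟩ := hH.sent_of_recv hd
      exact ih2 k hk l hl p m x v hs hm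
    constructor
    · intro p
      rcases hH.core_cases j p with hc | ⟨v, hd, rfl⟩ | ⟨k, q', m, y, v, hd, hm⟩
      · rw [hc.wsn, hc.reg, hc.swsn, hc.res]
        exact ih1 p
      · obtain ⟨b, hb⟩ := node_succ_of_does (t := t) (v₀ := v₀) hd
        rw [hb]
        exact ⟨Or.inr ⟨j, hd, rfl⟩, (ih1 p).2⟩
      · have hv := hrecv hd hm
        obtain ⟨rep, b, hb⟩ := node_succ_of_payload (t := t) (v₀ := v₀) hd hm
        rw [hb]
        constructor
        · simp only [LState.onWrite_wsn, LState.onWrite_reg]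
          split_ifs with hlt
          · rwa [max_eq_right hlt.le]
          · rw [max_eq_left (not_lt.1 hlt)]
            exact (ih1 p).1
        · rcases LState.onWrite_swsn_res t (nodeAt t v₀ H j p) q' y v with
            ⟨h1, h2, -⟩ | ⟨h1, h2, -⟩
          · simp only [h1, h2]
            exact hv
          · simp only [h1, h2]
            exact (ih1 p).2
    · intro k hk l hl d m x v hs hm
      rcases Nat.lt_succ_iff_lt_or_eq.1 hk with hk | rfl
      · exact ih2 k hk l hl d m x v hs hm
      · rcases hH.payload_sent_cases hl hs hm with
          ⟨h1, h2, h3⟩ | ⟨k', q, m', h1, h2⟩ | ⟨k', r, -, -, h3, h4⟩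
        · rw [h2] at h1 h3
          exact Or.inr ⟨k, h1, h3.symm⟩
        · exact hrecv h1 h2
        · rw [h3, h4]
          exact (ih1 l.who).1

/-- Origin of a report: the read that it answers was invoked before the answer was sent. -/
theorem IsRun.report_origin (hH : IsRun t w v₀ H) {j r x : ℕ} {p q : Fin n}
    (h : (q, x) ∈ (nodeAt t v₀ H j p).reports r) :
    ∃ i k, k < i ∧ i < j ∧ Does H i q (.recv k p (.read r)) ∧ x = (nodeAt t v₀ H i q).wsn ∧
      Does H k p .invRead ∧ (nodeAt t v₀ H k p).rsn + 1 = r := by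
  induction j with
  | zero => simp [nodeAt, configAt, LState.start] at h
  | succ j ih =>
    have lift : (q, x) ∈ (nodeAt t v₀ H j p).reports r → ∃ i k, k < i ∧ i < j + 1 ∧
        Does H i q (.recv k p (.read r)) ∧ x = (nodeAt t v₀ H i q).wsn ∧
        Does H k p .invRead ∧ (nodeAt t v₀ H k p).rsn + 1 = r := by
      intro h
      obtain ⟨i, k, h1, h2, h3⟩ := ih h
      exact ⟨i, k, h1, by omega, h3⟩
    rcases node_succ_cases (t := t) (v₀ := v₀) (H := H) j p with ⟨l, hl, hp, hn⟩ | ⟨-, hn⟩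
    · rw [hn] at h
      rcases LState.mem_reports_after (s := nodeAt t v₀ H j p) h with h | ⟨i, v, he⟩
      · exact lift h
      · have hd : Does H j p (.recv i q (.state r x v)) := ⟨l, hl, hp, he⟩
        obtain ⟨hi, l', hl', rfl, hs⟩ := hH.sent_of_recv hd
        have ho := hH.sent_mem_out hl' hs
        have hd' : Does H i l'.who l'.event := ⟨l', hl', rfl, rfl⟩
        generalize l'.event = e at ho hd'
        -- Relayed messages are `WRITE`s, so a `STATE` can only answer a `READ`, and likewise a
        -- `READ` can only come from an invocation.
        have hbc : ∀ y u, (p, Msg.state r x v) ∉ (nodeAt t v₀ H i l'.who).onWriteOut y u := by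
          intro y u hyu
          unfold LState.onWriteOut at hyu
          split_ifs at hyu <;> simp [bcast] at hyu
        cases e with
        | recv k src m =>
          cases m with
          | write y u => exact absurd ho (hbc y u)
          | state r' y u => exact absurd ho (hbc y u)
          | read r' =>
            simp only [LState.out, LState.onRecvOut, Set.mem_singleton_iff, Prod.mk.injEq,
              Msg.state.injEq] at ho
            obtain ⟨rfl, rfl, hx, -⟩ := ho
            obtain ⟨hk, l₂, hl₂, rfl, hs₂⟩ := hH.sent_of_recv hd'
            have ho₂ := hH.sent_mem_out hl₂ hs₂
            have hd₂ : Does H k l₂.who l₂.event := ⟨l₂, hl₂, rfl, rfl⟩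
            refine ⟨i, k, hk, by omega, hd', hx, ?_⟩
            generalize l₂.event = e at ho₂ hd₂
            have hbc₂ : ∀ y u,
                (l'.who, Msg.read r) ∉ (nodeAt t v₀ H k l₂.who).onWriteOut y u := by
              intro y u hyu
              unfold LState.onWriteOut at hyu
              split_ifs at hyu <;> simp [bcast] at hyu
            cases e with
            | invRead =>
              simp only [LState.out, bcast, Set.mem_ofPred_eq, Msg.read.injEq] at ho₂
              exact ⟨hd₂, ho₂.symm⟩
            | recv k' src' m' =>
              cases m' with
              | write y u => exact absurd ho₂ (hbc₂ y u)
              | state r' y u => exact absurd ho₂ (hbc₂ y u)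
              | read r' => simp [LState.out, LState.onRecvOut] at ho₂
            | _ => simp [LState.out, bcast] at ho₂
        | _ => simp [LState.out, bcast] at ho
    · rw [hn] at h
      exact lift h

/-! ### Clients -/

/-- Where the client code stands after the invocation `e`. -/
def Event.clientAfter : Event n V → Client
  | .invWrite _ => .writing
  | .invRead => .reading
  | .invReadLocal => .readingLocal
  | _ => .idle

/-- Invocations need an idle client and responses are excluded, so only receptions, crashes and
steps of other nodes remain. -/
theorem client_succ {j : ℕ} {p : Fin n} (hH : IsRun t w v₀ H)
    (hidle : (nodeAt t v₀ H j p).client ≠ .idle) (hr : ¬ Responds H j p) :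
    (nodeAt t v₀ H (j + 1) p).client = (nodeAt t v₀ H j p).client ∧
    (nodeAt t v₀ H (j + 1) p).rsn = (nodeAt t v₀ H j p).rsn ∧
    (p = w → (nodeAt t v₀ H (j + 1) p).wsn = (nodeAt t v₀ H j p).wsn) := by
  rw [← and_assoc]
  constructor
  · rcases node_succ_cases (t := t) (v₀ := v₀) (H := H) j p with ⟨l, hl, hp, hn⟩ | ⟨-, hn⟩
    · have hd : Does H j p l.event := ⟨l, hl, hp, rfl⟩
      rw [hn]
      generalize l.event = e at hd
      have hg := hH.guard hd
      cases e with
      | invWrite v => exact absurd hg.2 hidle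
      | invRead => exact absurd hg hidle
      | invReadLocal => exact absurd hg.2 hidle
      | recv k q m =>
        rcases hm : m.payload with _ | ⟨x, v⟩
        · simp [LState.after, LState.onRecv_of_payload_none hm]
        · obtain ⟨rep, h'⟩ := LState.onRecv_of_payload_some (t := t)
            (s := nodeAt t v₀ H j p) (src := q) hm
          simp [LState.after, h', LState.onWrite_client, LState.onWrite_rsn]
      | retWrite => exact absurd (Or.inl hd) hr
      | retRead v => exact absurd (Or.inr ⟨v, hd⟩) hr
      | halt => exact ⟨rfl, rfl⟩
    · rw [hn]
      exact ⟨rfl, rfl⟩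
  · rintro rfl
    exact hH.writer_wsn_succ fun v hd => hidle (hH.guard hd).2

/-- The client code of `p` stands still between an invocation and the next response. -/
theorem IsRun.client_during (hH : IsRun t w v₀ H) {k j : ℕ} {p : Fin n} {e : Event n V}
    (hd : Does H k p e) (he : e.clientAfter ≠ .idle) (hkj : k < j)
    (hr : ∀ i, k < i → i < j → ¬ Responds H i p) :
    (nodeAt t v₀ H j p).client = e.clientAfter ∧
    (nodeAt t v₀ H j p).rsn = (nodeAt t v₀ H (k + 1) p).rsn ∧
    (p = w → (nodeAt t v₀ H j p).wsn = (nodeAt t v₀ H (k + 1) p).wsn) := by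
  induction j, hkj using Nat.le_induction with
  | base =>
    refine ⟨?_, rfl, fun _ => rfl⟩
    obtain ⟨b, hb⟩ := node_succ_of_does (t := t) (v₀ := v₀) hd
    rw [hb]
    cases e <;> first | rfl | exact absurd rfl he
  | succ j hkj ih =>
    obtain ⟨h1, h2, h3⟩ := ih fun i hi hij => hr i hi (by omega)
    obtain ⟨h4, h5, h6⟩ := client_succ hH (by rw [h1]; exact he) (hr j hkj (by omega))
    exact ⟨h4.trans h1, h5.trans h2, fun hp => (h6 hp).trans (h3 hp)⟩

/-! ### Atomicity -/

theorem IsOp.exists_event {k : ℕ} {p : Fin n} (h : IsOp H k p) :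
    ∃ e, Does H k p e ∧ e.clientAfter ≠ .idle := by
  rcases h with (h | h) | ⟨v, h⟩
  · exact ⟨_, h, by simp [Event.clientAfter]⟩
  · exact ⟨_, h, by simp [Event.clientAfter]⟩
  · exact ⟨_, h, by simp [Event.clientAfter]⟩

theorem IsOp.node_unique {k : ℕ} {p q : Fin n} (h : IsOp H k p) (h' : IsOp H k q) : p = q := by
  obtain ⟨e, he, -⟩ := h.exists_event
  obtain ⟨f, hf, -⟩ := h'.exists_event
  exact (he.unique hf).1

theorem IsRead.not_isWrite {k : ℕ} {p q : Fin n} {v : V} (h : IsRead H k p) :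
    ¬ IsWrite H k q v := by
  intro h'
  rcases h with h | h
  · exact absurd (h.unique h').2 (by simp)
  · exact absurd (h.unique h').2 (by simp)

theorem ReturnsAt.unique {k m m' : ℕ} {p q : Fin n} (h : ReturnsAt H k p m)
    (h' : ReturnsAt H k q m') : p = q ∧ m = m' := by
  obtain rfl := h.1.node_unique h'.1
  refine ⟨rfl, ?_⟩
  rcases lt_trichotomy m m' with hlt | heq | hgt
  · exact absurd h.2.2.1 (h'.2.2.2 m h.2.1 hlt)
  · exact heq
  · exact absurd h'.2.2.1 (h.2.2.2 m' h'.2.1 hgt)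

theorem IsRun.isWrite_writer (hH : IsRun t w v₀ H) {k : ℕ} {p : Fin n} {v : V}
    (h : IsWrite H k p v) : p = w :=
  (hH.guard h).1

/-- The sequence number attached to an operation of `p` that returns in step `m`. -/
def retSeq (t : ℕ) (v₀ : V) (H : Schedule n V) (m : ℕ) (p : Fin n) : ℕ :=
  match (nodeAt t v₀ H m p).client with
  | .reading => (nodeAt t v₀ H m p).swsn
  | _ => (nodeAt t v₀ H m p).wsn

theorem IsRun.responds_client (hH : IsRun t w v₀ H) {m : ℕ} {p : Fin n} (h : Responds H m p) :
    ((nodeAt t v₀ H m p).client = .writing ∧ (nodeAt t v₀ H m p).writeReady t) ∨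
    ((nodeAt t v₀ H m p).client = .reading ∧ (nodeAt t v₀ H m p).readReady t) ∨
    (nodeAt t v₀ H m p).client = .readingLocal := by
  rcases h with h | ⟨v, h⟩
  · exact Or.inl (hH.guard h)
  · rcases hH.guard h with hg | hg
    · exact Or.inr (Or.inl ⟨hg.1, hg.2.1⟩)
    · exact Or.inr (Or.inr hg.1)

/-- The client of a node that returns from its operation is at the place where the invocation
has put it. -/
theorem ReturnsAt.client (hH : IsRun t w v₀ H) {k m : ℕ} {p : Fin n} {e : Event n V}
    (h : ReturnsAt H k p m) (he : Does H k p e) :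
    (nodeAt t v₀ H m p).client = e.clientAfter ∧
    (nodeAt t v₀ H m p).rsn = (nodeAt t v₀ H (k + 1) p).rsn ∧
    (p = w → (nodeAt t v₀ H m p).wsn = (nodeAt t v₀ H (k + 1) p).wsn) := by
  obtain ⟨f, hf, hi⟩ := h.1.exists_event
  obtain rfl := (he.unique hf).2
  exact hH.client_during he hi h.2.1 h.2.2.2

/-- The sequence number of a terminated operation is known to a quorum. -/
theorem ReturnsAt.quorum (hH : IsRun t w v₀ H) {k m : ℕ} {p : Fin n} (h : ReturnsAt H k p m) :
    retSeq t v₀ H m p = 0 ∨ ∃ A : Finset (Fin n), n - t ≤ A.card ∧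
      ∀ q ∈ A, retSeq t v₀ H m p ≤ (nodeAt t v₀ H m q).wsn := by
  unfold retSeq
  rcases hH.responds_client h.2.2.1 with ⟨h1, h2⟩ | ⟨h1, h2⟩ | h1
  · rw [h1]
    exact Or.inr ⟨_, h2, fun q hq => hH.le_wsn_of_mem_acks hq⟩
  · rw [h1]
    exact (hH.quorum_swsn m p).imp id fun h => ⟨_, h, fun q hq => hH.le_wsn_of_mem_acks hq⟩
  · rw [h1]
    obtain ⟨e, he, -⟩ := h.1.exists_event
    have hc := (h.client hH he).1
    rw [h1] at hc
    have hp : p = w := by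
      cases e with
      | invReadLocal => exact (hH.guard he).1
      | _ => simp [Event.clientAfter] at hc
    subst hp
    -- A local read returns the writer's own `wsn`; the writer is not inside a write, so a quorum
    -- has acknowledged that number.
    exact (hH.quorum_writer m (by rw [h1]; simp)).imp id
      fun h => ⟨_, h, fun q hq => hH.le_wsn_of_mem_acks hq⟩

theorem IsRun.retSeq_le_writer (hH : IsRun t w v₀ H) (htn : t < n) (m : ℕ) (p : Fin n) :
    retSeq t v₀ H m p ≤ (nodeAt t v₀ H m w).wsn := by
  unfold retSeq
  split
  · exact hH.swsn_le_writer htn m p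
  · exact hH.wsn_le_writer m p

/-- No new/old inversion: an operation that starts after the return of another one does not get
a smaller sequence number. -/
theorem ReturnsAt.retSeq_mono (hH : IsRun t w v₀ H) (ht : 2 * t < n) {k m k' m' : ℕ}
    {p p' : Fin n} (h : ReturnsAt H k p m) (h' : ReturnsAt H k' p' m') (hm : m < k') :
    retSeq t v₀ H m p ≤ retSeq t v₀ H m' p' := by
  have htn : t < n := by omega
  obtain ⟨e, he, hi⟩ := h'.1.exists_event
  have hle : retSeq t v₀ H m p ≤ (nodeAt t v₀ H m' w).wsn :=
    (hH.retSeq_le_writer htn m p).trans (wsn_mono w (hm.trans h'.2.1).le)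
  have hcl := h'.client hH he
  by_cases hr : e = .invRead
  · subst hr
    have hc : (nodeAt t v₀ H m' p').client = .reading := hcl.1
    have hready : (nodeAt t v₀ H m' p').readReady t := by
      rcases hH.responds_client h'.2.2.1 with ⟨h1, -⟩ | ⟨-, h2⟩ | h1
      · rw [hc] at h1; simp at h1
      · exact h2
      · rw [hc] at h1; simp at h1
    have hs : retSeq t v₀ H m' p' = (nodeAt t v₀ H m' p').swsn := by
      unfold retSeq
      rw [hc]
    rw [hs]
    rcases h.quorum hH with h0 | ⟨A, hA, hq⟩
    · omega
    -- Two disjoint sets of at least n - t nodes would need 2(n - t) > n nodes.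
    obtain ⟨q, hqA, hqB⟩ : ∃ q, q ∈ A ∧ q ∈ (((nodeAt t v₀ H m' p').reports
        (nodeAt t v₀ H m' p').rsn).image Prod.fst) := by
      by_contra hno
      push Not at hno
      have hdisj := Finset.card_union_of_disjoint (Finset.disjoint_left.2 hno)
      have hcard := Finset.card_le_univ (A ∪ (((nodeAt t v₀ H m' p').reports
        (nodeAt t v₀ H m' p').rsn).image Prod.fst))
      rw [Fintype.card_fin] at hcard
      have := hready.1
      omega
    obtain ⟨⟨q', x⟩, hx, rfl⟩ := Finset.mem_image.1 hqB
    refine le_trans ?_ (hready.2 _ hx)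
    obtain ⟨i, k₁, hk₁, hi, -, rfl, hinv, hrsn⟩ := hH.report_origin hx
    -- Each `invRead` increments `rsn`, so an answer bearing the current `rsn` was requested no
    -- earlier than this read and thus sent after step `m`.
    have hkk : k' ≤ k₁ := by
      by_contra hlt
      have h1 : (nodeAt t v₀ H (k₁ + 1) p').rsn ≤ (nodeAt t v₀ H k' p').rsn :=
        rsn_mono p' (by omega)
      obtain ⟨b, hb⟩ := node_succ_of_does (t := t) (v₀ := v₀) hinv
      obtain ⟨b', hb'⟩ := node_succ_of_does (t := t) (v₀ := v₀) he
      have h2 : (nodeAt t v₀ H (k' + 1) p').rsn = (nodeAt t v₀ H k' p').rsn + 1 := by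
        rw [hb']; rfl
      have := hcl.2.1
      have h3 : (nodeAt t v₀ H (k₁ + 1) p').rsn = (nodeAt t v₀ H k₁ p').rsn + 1 := by
        rw [hb]; rfl
      omega
    exact (hq q' hqA).trans (wsn_mono q' (by omega))
  · have hp : p' = w ∧ e.clientAfter ≠ .reading := by
      cases e with
      | invWrite v => exact ⟨(hH.guard he).1, by simp [Event.clientAfter]⟩
      | invRead => exact absurd rfl hr
      | invReadLocal => exact ⟨(hH.guard he).1, by simp [Event.clientAfter]⟩
      | _ => exact absurd rfl hi
    obtain ⟨rfl, hc⟩ := hp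
    have hs : retSeq t v₀ H m' p' = (nodeAt t v₀ H m' p').wsn := by
      unfold retSeq
      rw [hcl.1]
      split
      · exact absurd ‹_› hc
      · rfl
    rwa [hs]

open Classical in
/-- The sequence number attached to an operation. -/
noncomputable def opSeq (t : ℕ) (w : Fin n) (v₀ : V) (H : Schedule n V) (k : ℕ) : ℕ :=
  if ∃ v, IsWrite H k w v then (nodeAt t v₀ H k w).wsn + 1
  else if h : ∃ x : Fin n × ℕ, ReturnsAt H k x.1 x.2 then retSeq t v₀ H h.choose.2 h.choose.1
  -- Junk value for reads that never return; they are not in `Linearized`.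
  else 0

theorem opSeq_of_isWrite {k : ℕ} {v : V} (h : IsWrite H k w v) :
    opSeq t w v₀ H k = (nodeAt t v₀ H k w).wsn + 1 :=
  if_pos ⟨v, h⟩

theorem IsRun.opSeq_of_returnsAt (hH : IsRun t w v₀ H) {k m : ℕ} {p : Fin n}
    (h : ReturnsAt H k p m) : opSeq t w v₀ H k = retSeq t v₀ H m p := by
  by_cases hw : ∃ v, IsWrite H k w v
  · obtain ⟨v, hv⟩ := hw
    rw [opSeq_of_isWrite hv]
    obtain rfl := h.1.node_unique (Or.inr ⟨v, hv⟩)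
    obtain ⟨h1, -, h3⟩ := h.client hH hv
    unfold retSeq
    rw [h1, ← wsn_succ_of_invWrite hv]
    exact (h3 rfl).symm
  · have hex : ∃ x : Fin n × ℕ, ReturnsAt H k x.1 x.2 := ⟨(p, m), h⟩
    rw [opSeq, if_neg hw, dif_pos hex]
    obtain ⟨h1, h2⟩ := hex.choose_spec.unique h
    rw [h1, h2]

/-- The operations to be ordered: those that terminate, and the writes whose value has been
returned by a read. -/
def Linearized (t : ℕ) (w : Fin n) (v₀ : V) (H : Schedule n V) : Set ℕ :=
  {k | (∃ p m, ReturnsAt H k p m) ∨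
    ∃ v, IsWrite H k w v ∧ ∃ r p m, ReturnsAt H r p m ∧ retSeq t v₀ H m p = opSeq t w v₀ H k}

open Classical in
/-- Operations are ordered by sequence number, then writes before reads, then by invocation. -/
noncomputable def opKey (t : ℕ) (w : Fin n) (v₀ : V) (H : Schedule n V) (k : ℕ) : ℕ ×ₗ ℕ :=
  -- The shift `k + 1` keeps reads strictly above the 0 of the write with the same number. Distinct
  -- writes never tie, as their numbers differ.
  toLex (opSeq t w v₀ H k, if ∃ v, IsWrite H k w v then 0 else k + 1)

theorem opKey_lt_iff {k k' : ℕ} : opKey t w v₀ H k < opKey t w v₀ H k' ↔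
    opSeq t w v₀ H k < opSeq t w v₀ H k' ∨ (opSeq t w v₀ H k = opSeq t w v₀ H k' ∧
      (¬ ∃ v, IsWrite H k' w v) ∧ ((∃ v, IsWrite H k w v) ∨ k < k')) := by
  unfold opKey
  rw [Prod.Lex.toLex_lt_toLex]
  refine or_congr Iff.rfl (and_congr Iff.rfl ?_)
  by_cases h : ∃ v, IsWrite H k w v <;> by_cases h' : ∃ v, IsWrite H k' w v <;> simp [h, h']

theorem opSeq_lt_of_isWrite {k k' : ℕ} {v v' : V} (h : IsWrite H k w v)
    (h' : IsWrite H k' w v') (hlt : k < k') : opSeq t w v₀ H k < opSeq t w v₀ H k' := by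
  rw [opSeq_of_isWrite h, opSeq_of_isWrite h', ← wsn_succ_of_invWrite h]
  exact Nat.lt_succ_of_le (wsn_mono w hlt)

theorem eq_of_isWrite_of_opSeq_eq {k k' : ℕ} {v v' : V} (h : IsWrite H k w v)
    (h' : IsWrite H k' w v') (heq : opSeq t w v₀ H k = opSeq t w v₀ H k') : k = k' := by
  rcases lt_trichotomy k k' with hlt | he | hgt
  · exact absurd heq (opSeq_lt_of_isWrite h h' hlt).ne
  · exact he
  · exact absurd heq (opSeq_lt_of_isWrite h' h hgt).ne'

theorem opKey_injective : Function.Injective (opKey t w v₀ H) := by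
  intro k k' heq
  by_contra hne
  have h1 : ¬ opKey t w v₀ H k < opKey t w v₀ H k' := by rw [heq]; exact lt_irrefl _
  have h2 : ¬ opKey t w v₀ H k' < opKey t w v₀ H k := by rw [heq]; exact lt_irrefl _
  rw [opKey_lt_iff] at h1 h2
  push Not at h1 h2
  have hs : opSeq t w v₀ H k = opSeq t w v₀ H k' := le_antisymm h2.1 h1.1
  by_cases hk : ∃ v, IsWrite H k w v <;> by_cases hk' : ∃ v, IsWrite H k' w v
  · obtain ⟨v, hv⟩ := hk
    obtain ⟨v', hv'⟩ := hk'
    exact hne (eq_of_isWrite_of_opSeq_eq hv hv' hs)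
  · push Not at hk'
    obtain ⟨v, hv⟩ := hk
    exact (h1.2 hs hk').1 v hv
  · push Not at hk
    obtain ⟨v, hv⟩ := hk'
    exact (h2.2 hs.symm hk).1 v hv
  · push Not at hk hk'
    have := (h1.2 hs hk').2
    have := (h2.2 hs.symm hk).2
    omega

/-- An operation that starts after the return of another one does not get a smaller sequence
number, and gets a greater one if it is a write. -/
theorem ReturnsAt.opSeq_le (hH : IsRun t w v₀ H) (ht : 2 * t < n) {k m k' : ℕ} {p : Fin n}
    (h : ReturnsAt H k p m) (h' : k' ∈ Linearized t w v₀ H) (hm : m < k') :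
    retSeq t v₀ H m p ≤ opSeq t w v₀ H k' ∧
      ((∃ v, IsWrite H k' w v) → retSeq t v₀ H m p < opSeq t w v₀ H k') := by
  have hwr : (∃ v, IsWrite H k' w v) → retSeq t v₀ H m p < opSeq t w v₀ H k' := by
    rintro ⟨v, hv⟩
    rw [opSeq_of_isWrite hv]
    exact Nat.lt_succ_of_le ((hH.retSeq_le_writer (by omega) m p).trans (wsn_mono w hm.le))
  refine ⟨?_, hwr⟩
  rcases h' with ⟨p', m', h'⟩ | ⟨v, hv, -⟩
  · rw [hH.opSeq_of_returnsAt h']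
    exact h.retSeq_mono hH ht h' hm
  · exact (hwr ⟨v, hv⟩).le

/-- Every linearized operation shares its number with some terminated operation, itself or another.
Anything invoked after both that return and `k` has a larger key, so the predecessors lie below `max
m k`. -/
theorem IsRun.finite_opKey_lt (hH : IsRun t w v₀ H) (ht : 2 * t < n) {k : ℕ}
    (hk : k ∈ Linearized t w v₀ H) :
    {k' | k' ∈ Linearized t w v₀ H ∧ opKey t w v₀ H k' < opKey t w v₀ H k}.Finite := by
  obtain ⟨r, p, m, hr, hs⟩ : ∃ r p m, ReturnsAt H r p m ∧
      retSeq t v₀ H m p = opSeq t w v₀ H k := by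
    rcases hk with ⟨p, m, h⟩ | ⟨v, -, h⟩
    · exact ⟨k, p, m, h, (hH.opSeq_of_returnsAt h).symm⟩
    · exact h
  refine (Set.finite_Iic (max m k)).subset ?_
  rintro k' ⟨hk', hlt⟩
  rw [Set.mem_Iic]
  by_contra hgt
  obtain ⟨h1, h2⟩ := hr.opSeq_le hH ht hk' (by omega)
  rw [hs] at h1 h2
  rcases opKey_lt_iff.1 hlt with h | ⟨h3, -, h | h⟩
  · omega
  · have := h2 h
    omega
  · omega

/-- The place of an operation in the linearization. -/
noncomputable def opPos (t : ℕ) (w : Fin n) (v₀ : V) (H : Schedule n V) (k : ℕ) : ℕ :=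
  {k' | k' ∈ Linearized t w v₀ H ∧ opKey t w v₀ H k' < opKey t w v₀ H k}.ncard

theorem IsRun.opPos_lt (hH : IsRun t w v₀ H) (ht : 2 * t < n) {k k' : ℕ}
    (hk : k ∈ Linearized t w v₀ H) (hk' : k' ∈ Linearized t w v₀ H)
    (h : opKey t w v₀ H k < opKey t w v₀ H k') : opPos t w v₀ H k < opPos t w v₀ H k' := by
  refine Set.ncard_lt_ncard ?_ (hH.finite_opKey_lt ht hk')
  refine (Set.ssubset_iff_of_subset ?_).2 ⟨k, ⟨hk, h⟩, fun hc => lt_irrefl _ hc.2⟩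
  exact fun i hi => ⟨hi.1, hi.2.trans h⟩

/-- The value returned by a read is the one with its sequence number. -/
theorem IsRun.isVal_retSeq (hH : IsRun t w v₀ H) {m : ℕ} {p : Fin n} {v : V}
    (hv : Does H m p (.retRead v)) :
    IsVal t w v₀ H (retSeq t v₀ H m p) v := by
  have hval := (hH.isVal m).1 p
  unfold retSeq
  rcases hH.guard hv with ⟨h1, -, rfl⟩ | ⟨h1, rfl⟩
  · rw [show (nodeAt t v₀ H m p).client = _ from h1]
    exact hval.2
  · rw [show (nodeAt t v₀ H m p).client = _ from h1]
    exact hval.1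

theorem IsRun.atomic (hH : IsRun t w v₀ H) (ht : 2 * t < n) : Atomic v₀ H := by
  refine ⟨Linearized t w v₀ H, opPos t w v₀ H, ?_, fun k p m h => Or.inl ⟨p, m, h⟩, ?_, ?_, ?_⟩
  · rintro k (⟨p, m, h⟩ | ⟨v, hv, -⟩)
    · exact ⟨p, h.1⟩
    · exact ⟨w, Or.inr ⟨v, hv⟩⟩
  · intro k hk k' hk' heq
    rcases lt_trichotomy (opKey t w v₀ H k) (opKey t w v₀ H k') with h | h | h
    · exact absurd heq (hH.opPos_lt ht hk hk' h).ne
    · exact opKey_injective h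
    · exact absurd heq (hH.opPos_lt ht hk' hk h).ne'
  · rintro k hk k' hk' ⟨p, m, h, hm⟩
    refine hH.opPos_lt ht hk hk' (opKey_lt_iff.2 ?_)
    obtain ⟨h1, h2⟩ := h.opSeq_le hH ht hk' hm
    rw [← hH.opSeq_of_returnsAt h] at h1 h2
    rcases h1.lt_or_eq with h1 | h1
    · exact Or.inl h1
    · exact Or.inr ⟨h1, fun hw => (h2 hw).ne h1, Or.inr (h.2.1.trans hm)⟩
  · intro r hr p m v hread hret hv
    have hseq := hH.opSeq_of_returnsAt hret
    have hnw : ¬ ∃ u, IsWrite H r w u := fun ⟨u, hu⟩ => hread.not_isWrite hu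
    have hwr : ∀ k ∈ Linearized t w v₀ H, ∀ q u, IsWrite H k q u →
        opSeq t w v₀ H r < opSeq t w v₀ H k → opPos t w v₀ H r < opPos t w v₀ H k :=
      fun k hk q u _ hlt => hH.opPos_lt ht hr hk (opKey_lt_iff.2 (Or.inl hlt))
    rcases hH.isVal_retSeq hv with ⟨h0, rfl⟩ | ⟨k, hk, hkx⟩
    · refine Or.inl ⟨rfl, fun k hk q u hw => hwr k hk q u hw ?_⟩
      rw [hseq, h0]
      obtain rfl := hH.isWrite_writer hw
      rw [opSeq_of_isWrite hw]
      omega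
    · rw [← opSeq_of_isWrite hk] at hkx
      -- The write may never have returned; it is linearized because this read carries its number.
      have hkS : k ∈ Linearized t w v₀ H := Or.inr ⟨v, hk, r, p, m, hret, hkx.symm⟩
      refine Or.inr ⟨k, hkS, w, hk, ?_, ?_⟩
      · exact hH.opPos_lt ht hkS hr
          (opKey_lt_iff.2 (Or.inr ⟨by rw [hseq, hkx], hnw, Or.inl ⟨v, hk⟩⟩))
      · intro k' hk' q' u hw
        obtain rfl := hH.isWrite_writer hw
        rcases lt_trichotomy k' k with hlt | rfl | hgt
        · left
          exact (hH.opPos_lt ht hk' hkS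
            (opKey_lt_iff.2 (Or.inl (opSeq_lt_of_isWrite hw hk hlt)))).le
        · exact Or.inl le_rfl
        · right
          refine hwr k' hk' q' u hw ?_
          rw [hseq, ← hkx]
          exact opSeq_lt_of_isWrite hk hw hgt

/-! ### Broadcasts of writes -/

/-- In step `i`, node `p` sends `WRITE(x,-)` to all the nodes. -/
def Broadcasts (H : Schedule n V) (i : ℕ) (p : Fin n) (x : ℕ) : Prop :=
  ∃ l v, H i = some l ∧ l.who = p ∧ ∀ d, (d, Msg.write x v) ∈ l.sent

theorem LState.onRecvOut_of_payload {s : LState n V} {src : Fin n} {m : Msg V} {x : ℕ} {v : V}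
    (hm : m.payload = some (x, v)) : s.onRecvOut src m = s.onWriteOut x v := by
  cases m with
  | read r => simp [Msg.payload] at hm
  | _ =>
    simp only [Msg.payload, Option.some.injEq, Prod.mk.injEq] at hm
    obtain ⟨rfl, rfl⟩ := hm
    rfl

theorem IsRun.sent_eq_out (hH : IsRun t w v₀ H) {k : ℕ} {p : Fin n} {e : Event n V}
    (hd : Does H k p e) (hc : ¬ CrashesAt H k p) :
    ∃ l, H k = some l ∧ l.who = p ∧ l.sent = (nodeAt t v₀ H k p).out e := by
  obtain ⟨l, hl, rfl, rfl⟩ := hd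
  refine ⟨l, hl, rfl, (hH.allowed k l hl).2.2.2.2 ?_⟩
  by_contra hcr
  exact hc ⟨l, hl, rfl, by simpa using hcr⟩

theorem IsRun.broadcasts_of_invWrite (hH : IsRun t w v₀ H) {k : ℕ} {p : Fin n} {v : V}
    (hd : Does H k p (.invWrite v)) (hc : ¬ CrashesAt H k p) :
    Broadcasts H k p ((nodeAt t v₀ H k p).wsn + 1) := by
  obtain ⟨l, hl, hp, hs⟩ := hH.sent_eq_out hd hc
  exact ⟨l, v, hl, hp, fun d => by rw [hs]; simp [LState.out, bcast]⟩

/-- A node that has not crashed has indeed broadcast all that it has recorded as broadcast. -/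
theorem IsRun.broadcasts_of_mem_done (hH : IsRun t w v₀ H) {j x : ℕ} {p : Fin n}
    (h : x ∈ (nodeAt t v₀ H j p).done) (ha : (nodeAt t v₀ H j p).crashed = false) :
    ∃ i < j, Broadcasts H i p x := by
  induction j with
  | zero => simp [nodeAt, configAt, LState.start] at h
  | succ j ih =>
    have hnc : ∀ i < j + 1, ¬ CrashesAt H i p := by
      intro i hi hc
      rw [(hH.crashed_iff (j + 1) p).2 ⟨i, hi, hc⟩] at ha
      simp at ha
    have ha' : (nodeAt t v₀ H j p).crashed = false := by
      by_contra hcr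
      obtain ⟨i, hi, hc⟩ := (hH.crashed_iff j p).1 (by simpa using hcr)
      exact hnc i (by omega) hc
    by_cases hx : x ∈ (nodeAt t v₀ H j p).done
    · obtain ⟨i, hi, hb⟩ := ih hx ha'
      exact ⟨i, by omega, hb⟩
    -- Here `x` enters `done` in step `j` itself: the test before relaying succeeds, and as the node
    -- does not crash in that step the sending is complete.
    · refine ⟨j, by omega, ?_⟩
      rcases hH.core_cases j p with hc | ⟨v, hd, -⟩ | ⟨k, q, m, y, v, hd, hm⟩
      · rw [hc.done] at h
        exact absurd h hx
      · obtain ⟨b, hb⟩ := node_succ_of_does (t := t) (v₀ := v₀) hd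
        rw [hb] at h
        rcases Finset.mem_insert.1 h with rfl | h
        · exact hH.broadcasts_of_invWrite hd (hnc j (by omega))
        · exact absurd h hx
      · rw [done_succ_of_payload hd hm] at h
        rcases Finset.mem_insert.1 h with rfl | h
        · obtain ⟨l, hl, hp, hs⟩ := hH.sent_eq_out hd (hnc j (by omega))
          refine ⟨l, v, hl, hp, fun d => ?_⟩
          rw [hs]
          simp only [LState.out, LState.onRecvOut_of_payload hm, LState.onWriteOut]
          rw [if_pos (Or.inr hx)]
          rfl
        · exact absurd h hx

/-- Combined with `broadcasts_of_mem_done`: the nonzero number held by a live node has already been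
sent to all nodes. The 3Δ bound depends on this. -/
theorem IsRun.wsn_mem_done (hH : IsRun t w v₀ H) (j : ℕ) (p : Fin n) :
    (nodeAt t v₀ H j p).wsn = 0 ∨ (nodeAt t v₀ H j p).wsn ∈ (nodeAt t v₀ H j p).done := by
  induction j with
  | zero => simp [nodeAt, configAt, LState.start]
  | succ j ih =>
    rcases hH.core_cases j p with hc | ⟨v, hd, -⟩ | ⟨k, q, m, y, v, hd, hm⟩
    · rw [hc.wsn, hc.done]
      exact ih
    · obtain ⟨b, hb⟩ := node_succ_of_does (t := t) (v₀ := v₀) hd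
      rw [hb]
      exact Or.inr (Finset.mem_insert_self _ _)
    · rw [wsn_succ_of_payload hd hm, done_succ_of_payload hd hm]
      rcases le_total (nodeAt t v₀ H j p).wsn y with h | h
      · rw [max_eq_right h]
        exact Or.inr (Finset.mem_insert_self _ _)
      · rw [max_eq_left h]
        exact ih.imp id fun h => Finset.mem_insert_of_mem h

/-! ### Timed runs -/

/-- Merging finitely many thresholds does not delay the deadline: the maximum of two indices is one
of them, so its date is also at most `T`. -/
theorem exists_uniform_bound {ι : Type*} {time : ℕ → ℝ} {T : ℝ} (s : Finset ι)
    {P : ι → ℕ → Prop} {i₀ : ℕ} (h₀ : time i₀ ≤ T)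
    (h : ∀ a ∈ s, ∃ J, time J ≤ T ∧ ∀ j, J < j → P a j) :
    ∃ J, i₀ ≤ J ∧ time J ≤ T ∧ ∀ j, J < j → ∀ a ∈ s, P a j := by
  classical
  induction s using Finset.induction_on with
  | empty => exact ⟨i₀, le_rfl, h₀, by simp⟩
  | insert a s _ ih =>
    obtain ⟨J₁, hle, h1, h2⟩ := ih fun b hb => h b (Finset.mem_insert_of_mem hb)
    obtain ⟨J₂, h3, h4⟩ := h a (Finset.mem_insert_self a s)
    refine ⟨max J₁ J₂, hle.trans (le_max_left _ _), ?_, fun j hj b hb => ?_⟩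
    · rcases max_choice J₁ J₂ with h | h <;> rw [h] <;> assumption
    · rcases Finset.mem_insert.1 hb with rfl | hb
      · exact h4 j ((le_max_right _ _).trans_lt hj)
      · exact h2 j ((le_max_left _ _).trans_lt hj) b hb

open Classical in
/-- The nodes that do not crash. -/
noncomputable def correctNodes (H : Schedule n V) : Finset (Fin n) :=
  Finset.univ.filter fun p => ¬ Faulty H p

theorem mem_correctNodes {p : Fin n} : p ∈ correctNodes H ↔ ¬ Faulty H p := by
  simp [correctNodes]

theorem IsRun.card_correctNodes (hH : IsRun t w v₀ H) : n - t ≤ (correctNodes H).card := by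
  classical
  have h := hH.crashes
  have h1 : {p | Faulty H p}.ncard = (Finset.univ.filter fun p => Faulty H p).card := by
    rw [← Set.ncard_coe_finset]
    congr 1
    ext p
    simp
  have h2 := Finset.card_filter_add_card_filter_not (s := Finset.univ) (fun p => Faulty H p)
  rw [Finset.card_univ, Fintype.card_fin] at h2
  have h3 : (correctNodes H).card = (Finset.univ.filter fun p => ¬ Faulty H p).card := rfl
  omega

theorem EndedBy.mono {k j j' : ℕ} {p : Fin n} (h : EndedBy H k p j) (hj : j ≤ j') :
    EndedBy H k p j' := by
  obtain ⟨i, h1, h2, h3⟩ := h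
  exact ⟨i, h1, h2.trans hj, h3⟩

theorem IsRun.endedBy_of_crashesAt (hH : IsRun t w v₀ H) {k j : ℕ} {p : Fin n} {e : Event n V}
    (hd : Does H k p e) (hc : CrashesAt H j p) : EndedBy H k p j :=
  ⟨j, not_lt.1 fun h => hH.not_crashesAt_of_does hd h hc, le_rfl, Or.inl hc⟩

theorem IsRun.state_of_not_endedBy (hH : IsRun t w v₀ H) {k j : ℕ} {p : Fin n} {e : Event n V}
    (hd : Does H k p e) (he : e.clientAfter ≠ .idle) (hkj : k ≤ j) (h : ¬ EndedBy H k p j) :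
    (nodeAt t v₀ H (j + 1) p).crashed = false ∧
    (nodeAt t v₀ H (j + 1) p).client = e.clientAfter ∧
    (nodeAt t v₀ H (j + 1) p).rsn = (nodeAt t v₀ H (k + 1) p).rsn ∧
    (p = w → (nodeAt t v₀ H (j + 1) p).wsn = (nodeAt t v₀ H (k + 1) p).wsn) := by
  constructor
  · by_contra hcr
    obtain ⟨i, hi, hc⟩ := (hH.crashed_iff (j + 1) p).1 (by simpa using hcr)
    exact h ((hH.endedBy_of_crashesAt hd hc).mono (by omega))
  · exact hH.client_during hd he (by omega)
      fun i hi hij hr => h ⟨i, hi.le, by omega, Or.inr ⟨hi, hr⟩⟩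

section Timed

variable {time : ℕ → ℝ} {Δ : ℝ}

/-- An operation that can return from step `J` on ends within the time of step `J`. -/
theorem takesAtMost_of_canReturn (hH : IsRun t w v₀ H) (hB : BoundedDelay t w v₀ H time Δ)
    {k J : ℕ} {p : Fin n} {e : Event n V} {D : ℝ} (hd : Does H k p e) (hkJ : k ≤ J)
    (hJ : time J ≤ time k + D)
    (hret : ∀ j, J ≤ j → ¬ EndedBy H k p j → CanReturn t w (configAt t v₀ H (j + 1)) p) :
    TakesAtMost H time k p D := by
  by_contra hno
  have hend : ∀ j, time j ≤ time k + D → ¬ EndedBy H k p j := fun j h1 h2 => hno ⟨j, h1, h2⟩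
  -- While the operation can return the clock is frozen by `urgent`, so all later steps meet the
  -- deadline. A crash or the response granted by `progress` then ends the operation in time.
  have htime : ∀ j, J ≤ j → time j ≤ time k + D := by
    intro j hj
    induction j, hj using Nat.le_induction with
    | base => exact hJ
    | succ j hj ih =>
      rw [hB.urgent j p (hret j hj (hend j ih))]
      exact ih
  have hnf : ¬ Faulty H p := by
    rintro ⟨i, hi⟩
    exact hend _ (htime (max i J) (le_max_right _ _))
      ((hH.endedBy_of_crashesAt hd hi).mono (le_max_left _ _))
  obtain ⟨j, hj, hr⟩ := hH.progress p hnf (J + 1) fun j hj => by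
    obtain ⟨i, rfl⟩ := Nat.exists_eq_add_of_lt hj
    exact hret (J + i) (by omega) (hend _ (htime _ (by omega)))
  exact hend j (htime j (by omega)) ⟨j, by omega, le_rfl, Or.inr ⟨by omega, hr⟩⟩

/-- When a node has broadcast a write, each node gets a quorum of acknowledgments of it within
`2Δ`. -/
theorem Broadcasts.quorum (hH : IsRun t w v₀ H) (hB : BoundedDelay t w v₀ H time Δ)
    (hΔ : 0 ≤ Δ) {i x : ℕ} {q : Fin n} (h : Broadcasts H i q x) {p : Fin n}
    (hp : ∀ j, time j ≤ time i + 2 * Δ → ¬ CrashesAt H j p) :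
    ∃ J, time J ≤ time i + 2 * Δ ∧
      ∀ j, J < j → n - t ≤ ((nodeAt t v₀ H j p).acks x).card := by
  obtain ⟨l, v, hl, -, hs⟩ := h
  have key : ∀ d ∈ correctNodes H, ∃ J, time J ≤ time i + 2 * Δ ∧
      ∀ j, J < j → d ∈ (nodeAt t v₀ H j p).acks x := by
    intro d hd
    rw [mem_correctNodes] at hd
    obtain ⟨j₁, hj₁, h1⟩ := hB.delay i l hl d _ (hs d)
    have h1 := h1.resolve_left fun hc => hd ⟨j₁, hc⟩
    -- Going through `done` covers both cases at once: `d` relays on this reception or had broadcast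
    -- `x` before. The value `v'` it sent is irrelevant, since acknowledgments count numbers only.
    have hdone : x ∈ (nodeAt t v₀ H (j₁ + 1) d).done := by
      rw [done_succ_of_payload (x := x) (v := v) h1 rfl]
      exact Finset.mem_insert_self _ _
    have halive : (nodeAt t v₀ H (j₁ + 1) d).crashed = false := by
      by_contra hcr
      obtain ⟨i', -, hc⟩ := (hH.crashed_iff (j₁ + 1) d).1 (by simpa using hcr)
      exact hd ⟨i', hc⟩
    obtain ⟨i', hi', l', v', hl', rfl, hs'⟩ := hH.broadcasts_of_mem_done hdone halive
    have htime : time i' ≤ time j₁ := hB.mono (by omega)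
    obtain ⟨j₂, hj₂, h2⟩ := hB.delay i' l' hl' p _ (hs' p)
    have hle : time j₂ ≤ time i + 2 * Δ := by linarith
    have h2 := h2.resolve_left (hp j₂ hle)
    refine ⟨j₂, hle, fun j hj => acks_mono p x hj ?_⟩
    simp only [Nat.succ_eq_add_one]
    rw [acks_succ_of_payload (x := x) (v := v') h2 rfl]
    simp
  obtain ⟨J, -, hJ, h⟩ := exists_uniform_bound (i₀ := i) _ (by linarith) key
  exact ⟨J, hJ, fun j hj => hH.card_correctNodes.trans (Finset.card_le_card fun d => h j hj d)⟩

theorem IsRun.write_takesAtMost (hH : IsRun t w v₀ H) (hB : BoundedDelay t w v₀ H time Δ)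
    (hΔ : 0 ≤ Δ) {k : ℕ} {v : V} (h : IsWrite H k w v) : TakesAtMost H time k w (2 * Δ) := by
  by_contra hno
  have hend : ∀ j, time j ≤ time k + 2 * Δ → ¬ EndedBy H k w j := fun j h1 h2 => hno ⟨j, h1, h2⟩
  have hnc : ∀ j, time j ≤ time k + 2 * Δ → ¬ CrashesAt H j w :=
    fun j hj hc => hend j hj (hH.endedBy_of_crashesAt h hc)
  obtain ⟨J, hJ, hq⟩ :=
    (hH.broadcasts_of_invWrite h (hnc k (by linarith))).quorum hH hB hΔ (p := w) hnc
  refine hno (takesAtMost_of_canReturn hH hB h (le_max_left k J) ?_ ?_)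
  · rcases max_choice k J with h | h <;> rw [h] <;> linarith
  · intro j hj hne
    obtain ⟨h1, h2, -, h4⟩ := hH.state_of_not_endedBy h (by simp [Event.clientAfter])
      ((le_max_left k J).trans hj) hne
    refine ⟨h1, Or.inl ⟨h2, ?_⟩⟩
    have := hq (j + 1) (by omega)
    rwa [← wsn_succ_of_invWrite h, ← h4 rfl] at this

theorem IsRun.readLocal_takesAtMost (hH : IsRun t w v₀ H) (hB : BoundedDelay t w v₀ H time Δ)
    {D : ℝ} (hD : 0 ≤ D) {k : ℕ} {p : Fin n} (h : Does H k p .invReadLocal) :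
    TakesAtMost H time k p D := by
  refine takesAtMost_of_canReturn hH hB h le_rfl (by linarith) fun j hj hne => ?_
  obtain ⟨h1, h2, -, -⟩ := hH.state_of_not_endedBy h (by simp [Event.clientAfter]) hj hne
  exact ⟨h1, Or.inr ⟨_, Or.inr ⟨h2, rfl⟩⟩⟩

/-- The step that invokes a read with given sequence number is unique. -/
theorem eq_of_invRead_of_rsn_eq {k k' : ℕ} {p : Fin n} (h : Does H k p .invRead)
    (h' : Does H k' p .invRead) (heq : (nodeAt t v₀ H k p).rsn = (nodeAt t v₀ H k' p).rsn) :
    k = k' := by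
  have key : ∀ {a b : ℕ}, Does H a p .invRead → a < b →
      (nodeAt t v₀ H a p).rsn < (nodeAt t v₀ H b p).rsn := by
    intro a b ha hab
    obtain ⟨c, hc⟩ := node_succ_of_does (t := t) (v₀ := v₀) ha
    refine lt_of_lt_of_le ?_ (rsn_mono p (show a + 1 ≤ b from hab))
    simp only [hc, LState.after]
    omega
  rcases lt_trichotomy k k' with hlt | he | hgt
  · exact absurd heq (key h hlt).ne
  · exact he
  · exact absurd heq (key h' hgt).ne'

theorem IsRun.readRequest_sent (hH : IsRun t w v₀ H) {r : ℕ} {p : Fin n}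
    (h : Does H r p .invRead) (hc : ¬ CrashesAt H r p) (d : Fin n) :
    ∃ l, H r = some l ∧ l.who = p ∧
      (d, Msg.read ((nodeAt t v₀ H r p).rsn + 1)) ∈ l.sent := by
  obtain ⟨l, hl, hp, hs⟩ := hH.sent_eq_out h hc
  exact ⟨l, hl, hp, by rw [hs]; simp [LState.out, bcast]⟩

/-- All the answers to a read are sent within `Δ`. -/
theorem IsRun.reports_bound (hH : IsRun t w v₀ H) (hB : BoundedDelay t w v₀ H time Δ)
    (hΔ : 0 ≤ Δ) {r : ℕ} {p : Fin n} (h : Does H r p .invRead) (hc : ¬ CrashesAt H r p) :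
    ∃ N, time N ≤ time r + Δ ∧ ∀ j q x,
      (q, x) ∈ (nodeAt t v₀ H j p).reports ((nodeAt t v₀ H r p).rsn + 1) →
      ∃ i ≤ N, (nodeAt t v₀ H i q).crashed = false ∧ x = (nodeAt t v₀ H i q).wsn := by
  obtain ⟨N, -, hN, hall⟩ := exists_uniform_bound (i₀ := r) (time := time) (T := time r + Δ)
    (Finset.univ : Finset (Fin n))
    (P := fun q j => ∀ i, Does H i q (.recv r p (.read ((nodeAt t v₀ H r p).rsn + 1))) → i < j)
    (by linarith) (by
      intro q _
      obtain ⟨l, hl, rfl, hs⟩ := hH.readRequest_sent h hc q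
      obtain ⟨J, hJ, hor⟩ := hB.delay r l hl q _ hs
      refine ⟨J, hJ, fun j hj i hi => lt_of_le_of_lt ?_ hj⟩
      -- Within Δ, `q` either crashes, and receives nothing afterwards, or receives the request, and
      -- does so only once.
      rcases hor with hcr | hrec
      · exact not_lt.1 fun hlt => hH.not_crashesAt_of_does hi hlt hcr
      · exact hH.recv_le hrec hi)
  refine ⟨N, hN, fun j q x hx => ?_⟩
  obtain ⟨i, k, -, -, hrec, hxi, hinv, hrsn⟩ := hH.report_origin hx
  obtain rfl : k = r := eq_of_invRead_of_rsn_eq (t := t) (v₀ := v₀) hinv h (by omega)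
  exact ⟨i, Nat.lt_succ_iff.1 (hall (N + 1) (by omega) q (Finset.mem_univ q) i hrec),
    hH.alive hrec, hxi⟩

/-- A read gets a quorum of answers within `2Δ`. -/
theorem IsRun.reports_quorum (hH : IsRun t w v₀ H) (hB : BoundedDelay t w v₀ H time Δ)
    (hΔ : 0 ≤ Δ) {r : ℕ} {p : Fin n} (h : Does H r p .invRead)
    (hp : ∀ j, time j ≤ time r + 2 * Δ → ¬ CrashesAt H j p) :
    ∃ J, r ≤ J ∧ time J ≤ time r + 2 * Δ ∧ ∀ j, J < j → n - t ≤
      (((nodeAt t v₀ H j p).reports ((nodeAt t v₀ H r p).rsn + 1)).image Prod.fst).card := by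
  have key : ∀ d ∈ correctNodes H, ∃ J, time J ≤ time r + 2 * Δ ∧ ∀ j, J < j → d ∈
      ((nodeAt t v₀ H j p).reports ((nodeAt t v₀ H r p).rsn + 1)).image Prod.fst := by
    intro d hd
    rw [mem_correctNodes] at hd
    obtain ⟨l, hl, rfl, hs⟩ := hH.readRequest_sent h (hp r (by linarith)) d
    obtain ⟨j₁, hj₁, h1⟩ := hB.delay r l hl d _ hs
    have h1 := h1.resolve_left fun hc => hd ⟨j₁, hc⟩
    obtain ⟨l', hl', rfl, hs'⟩ := hH.sent_eq_out h1 fun hc => hd ⟨j₁, hc⟩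
    obtain ⟨j₂, hj₂, h2⟩ := hB.delay j₁ l' hl' l.who
      (.state ((nodeAt t v₀ H r l.who).rsn + 1) (nodeAt t v₀ H j₁ l'.who).wsn
        (nodeAt t v₀ H j₁ l'.who).reg) (by rw [hs']; rfl)
    have hle : time j₂ ≤ time r + 2 * Δ := by linarith
    have h2 := h2.resolve_left (hp j₂ hle)
    refine ⟨j₂, hle, fun j hj => Finset.mem_image.2
      ⟨(l'.who, (nodeAt t v₀ H j₁ l'.who).wsn), reports_mono l.who _ hj ?_, rfl⟩⟩
    obtain ⟨b, hb⟩ := node_succ_of_does (t := t) (v₀ := v₀) h2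
    simp only [Nat.succ_eq_add_one]
    rw [hb]
    simp [LState.after, LState.onRecv]
  obtain ⟨J, hrJ, hJ, h⟩ := exists_uniform_bound (i₀ := r) _ (by linarith) key
  exact ⟨J, hrJ, hJ,
    fun j hj => hH.card_correctNodes.trans (Finset.card_le_card fun d => h j hj d)⟩

/-- A read takes at most `D ≥ 2Δ` if all the sequence numbers known when its answers are sent
are broadcast at least `2Δ` before its deadline. -/
theorem IsRun.read_takesAtMost (hH : IsRun t w v₀ H) (htn : t < n)
    (hB : BoundedDelay t w v₀ H time Δ) (hΔ : 0 ≤ Δ) {r : ℕ} {p : Fin n} {D : ℝ}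
    (hD : 2 * Δ ≤ D) (h : IsRead H r p)
    (hE : ∀ N, time N ≤ time r + Δ → ¬ EndedBy H r p N → ∀ i ≤ N, ∀ q,
      (nodeAt t v₀ H i q).crashed = false → (nodeAt t v₀ H i q).wsn ≠ 0 →
      ∃ i' q', time i' + 2 * Δ ≤ time r + D ∧ Broadcasts H i' q' (nodeAt t v₀ H i q).wsn) :
    TakesAtMost H time r p D := by
  rcases h with h | h
  swap
  · exact hH.readLocal_takesAtMost hB (by linarith) h
  by_contra hno
  have hend : ∀ j, time j ≤ time r + D → ¬ EndedBy H r p j := fun j h1 h2 => hno ⟨j, h1, h2⟩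
  have hnc : ∀ j, time j ≤ time r + D → ¬ CrashesAt H j p :=
    fun j hj hc => hend j hj (hH.endedBy_of_crashesAt h hc)
  obtain ⟨N, hN, hrep⟩ := hH.reports_bound hB hΔ h (hnc r (by linarith))
  obtain ⟨J₁, hrJ₁, hJ₁, hq⟩ := hH.reports_quorum hB hΔ h fun j hj => hnc j (by linarith)
  -- Numbers carried by answers are at most the writer's counter at step `N`, so finitely many
  -- thresholds have to be merged.
  obtain ⟨J, hle, hJ, hall⟩ := exists_uniform_bound (i₀ := J₁) (time := time)
    (T := time r + D) (Finset.range ((nodeAt t v₀ H N w).wsn + 1))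
    (P := fun x j => (∃ i ≤ N, ∃ q, (nodeAt t v₀ H i q).crashed = false ∧
      x = (nodeAt t v₀ H i q).wsn) → x ≤ (nodeAt t v₀ H j p).swsn) (by linarith) (by
      intro x _
      by_cases hx : ∃ i ≤ N, ∃ q, (nodeAt t v₀ H i q).crashed = false ∧
        x = (nodeAt t v₀ H i q).wsn
      · obtain ⟨i, hi, q, ha, rfl⟩ := hx
        by_cases h0 : (nodeAt t v₀ H i q).wsn = 0
        · exact ⟨J₁, by linarith, fun j _ _ => by omega⟩
        · obtain ⟨i', q', hi', hb⟩ := hE N hN (hend N (by linarith)) i hi q ha h0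
          obtain ⟨J, hJ, hcard⟩ := hb.quorum hH hB hΔ (p := p) fun j hj => hnc j (by linarith)
          exact ⟨J, by linarith, fun j hj _ => hH.le_swsn_of_quorum htn (hcard j hj)⟩
      · exact ⟨J₁, by linarith, fun j _ hx' => absurd hx' hx⟩)
  refine hno (takesAtMost_of_canReturn hH hB h (hrJ₁.trans hle) hJ fun j hj hne => ?_)
  obtain ⟨h1, h2, h3, -⟩ := hH.state_of_not_endedBy h (by simp [Event.clientAfter])
    ((hrJ₁.trans hle).trans hj) hne
  have hrsn : (nodeAt t v₀ H (j + 1) p).rsn = (nodeAt t v₀ H r p).rsn + 1 := by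
    obtain ⟨b, hb⟩ := node_succ_of_does (t := t) (v₀ := v₀) h
    rw [h3, hb]
    rfl
  refine ⟨h1, Or.inr ⟨_, Or.inl ⟨h2, ⟨?_, ?_⟩, rfl⟩⟩⟩
  · have := hq (j + 1) (by omega)
    rwa [← hrsn] at this
  · rintro ⟨q, x⟩ hx
    rw [hrsn] at hx
    obtain ⟨i, hi, ha, hxi⟩ := hrep (j + 1) q x hx
    refine hall (j + 1) (by omega) x (Finset.mem_range.2 ?_) ⟨i, hi, q, ha, hxi⟩
    rw [hxi]
    exact Nat.lt_succ_of_le ((hH.wsn_le_writer i q).trans (wsn_mono w hi))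

/-- Every read takes at most `3Δ`. -/
theorem IsRun.read_takesAtMost_three (hH : IsRun t w v₀ H) (htn : t < n)
    (hB : BoundedDelay t w v₀ H time Δ) (hΔ : 0 ≤ Δ) {r : ℕ} {p : Fin n}
    (h : IsRead H r p) : TakesAtMost H time r p (3 * Δ) := by
  -- The answering node is alive and had broadcast its number by step `N`, hence by τ_r + Δ; two
  -- more delays give 3Δ.
  refine hH.read_takesAtMost htn hB hΔ (by linarith) h fun N hN _ i hi q ha h0 => ?_
  obtain ⟨i', hi', hb⟩ :=
    hH.broadcasts_of_mem_done ((hH.wsn_mem_done i q).resolve_left h0) ha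
  have : time i' ≤ time N := hB.mono (by omega)
  exact ⟨i', q, by linarith, hb⟩

theorem exists_closestWrite {k r : ℕ} {v : V} (h : IsWrite H k w v) (hkr : k < r) :
    ∃ K, k ≤ K ∧ ClosestWrite w H K r := by
  classical
  have hne : ((Finset.range r).filter fun k => ∃ v, IsWrite H k w v).Nonempty :=
    ⟨k, by simp only [Finset.mem_filter, Finset.mem_range]; exact ⟨hkr, v, h⟩⟩
  obtain ⟨K, hmem, hle⟩ := Finset.exists_max_image _ id hne
  simp only [Finset.mem_filter, Finset.mem_range, id] at hmem hle
  exact ⟨K, hle k ⟨hkr, v, h⟩, hmem.1, hmem.2, fun k' v' h1 h2 => hle k' ⟨h1, v', h2⟩⟩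

/-- A write-latency-free read takes at most `2Δ`. -/
theorem IsRun.read_takesAtMost_two (hH : IsRun t w v₀ H) (htn : t < n)
    (hB : BoundedDelay t w v₀ H time Δ) (hΔ : 0 ≤ Δ) {r : ℕ} {p : Fin n}
    (h : IsRead H r p) (hfree : WriteLatencyFree w H time Δ r p) :
    TakesAtMost H time r p (2 * Δ) := by
  refine hH.read_takesAtMost htn hB hΔ le_rfl h fun N hN hne i hi q ha h0 => ?_
  obtain ⟨k, hk, hkx⟩ := (((hH.isVal i).1 q).1).resolve_left fun hc => h0 hc.1
  have hki : k < i := by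
    by_contra hik
    have h1 : (nodeAt t v₀ H i w).wsn ≤ (nodeAt t v₀ H k w).wsn := wsn_mono w (not_lt.1 hik)
    have h2 := hH.wsn_le_writer i q
    omega
  -- A write invoked after the read, yet known by step `N` while the read is still running, would be
  -- concurrent with it.
  have hkr : k < r := by
    by_contra hrk
    refine hfree.1 k _ hk ⟨?_, fun he => hne (he.mono (by omega))⟩
    rintro ⟨j, h1, h2, hor⟩
    obtain rfl : k = r := by omega
    exact h.not_isWrite hk
  obtain ⟨K, hkK, hK⟩ := exists_closestWrite hk hkr
  obtain ⟨hnc, htime⟩ := hfree.2 K hK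
  -- The closest write does not crash by hypothesis; at an earlier write the writer cannot have
  -- crashed, since it went on to invoke `K`.
  have hnck : ¬ CrashesAt H k w := by
    intro hc
    rcases hkK.lt_or_eq with hlt | rfl
    · obtain ⟨u, hu⟩ := hK.2.1
      exact hH.not_crashesAt_of_does hu hlt hc
    · exact hnc ⟨k, le_rfl, hc, fun j h1 h2 => by omega⟩
  have htk : time k ≤ time K := hB.mono hkK
  rw [← hkx]
  exact ⟨k, w, by linarith, hH.broadcasts_of_invWrite hk hnck⟩

/-- The uniform 3Δ bound gives both cases of reads that are not write-latency-free, and makes the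
last clause vacuous. -/
theorem IsRun.timeEfficient (hH : IsRun t w v₀ H) (htn : t < n)
    (hB : BoundedDelay t w v₀ H time Δ) (hΔ : 0 ≤ Δ) : TimeEfficient w H time Δ where
  write _ _ h := hH.write_takesAtMost hB hΔ h
  readFree _ _ h hf := hH.read_takesAtMost_two htn hB hΔ h hf
  readNoCrash _ _ h _ _ := hH.read_takesAtMost_three htn hB hΔ h
  readCrash _ _ h _ _ := by
    obtain ⟨j, hj, he⟩ := hH.read_takesAtMost_three htn hB hΔ h
    exact ⟨j, by linarith, he⟩
  atMostOnce _ _ _ h _ hno _ := absurd (hH.read_takesAtMost_three htn hB hΔ h) hno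

end Timed

/-! ### Liveness -/

/-- Without real-time clocks, every run is a run with delays bounded by `0`. -/
theorem IsRun.boundedDelay_zero (hH : IsRun t w v₀ H) :
    BoundedDelay t w v₀ H (fun _ => 0) 0 where
  mono := monotone_const
  delay k l hl d m hm := by
    by_cases hd : Faulty H d
    · obtain ⟨j, hj⟩ := hd
      exact ⟨j, by simp, Or.inl hj⟩
    · obtain ⟨j, hj⟩ := hH.reliable k l hl d m hm hd
      exact ⟨j, by simp, Or.inr hj⟩
  urgent _ _ _ := rfl

/-- Under the constant clock, `TakesAtMost` merely says that the operation ends at some step, and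
for a correct node it ends by a response. The least such step is taken because `ReturnsAt` asks for
the first response. -/
theorem IsRun.terminating (hH : IsRun t w v₀ H) (htn : t < n) : Terminating H := by
  classical
  intro k p hop hnf
  have hT : ∃ D, TakesAtMost H (fun _ => 0) k p D := by
    rcases hop with h | ⟨v, h⟩
    · exact ⟨_, hH.read_takesAtMost_three htn hH.boundedDelay_zero le_rfl h⟩
    · obtain rfl := hH.isWrite_writer h
      exact ⟨_, hH.write_takesAtMost hH.boundedDelay_zero le_rfl h⟩
  obtain ⟨D, j, -, i, -, -, hor⟩ := hT
  have hex : ∃ m, k < m ∧ Responds H m p :=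
    ⟨i, hor.resolve_left fun hc => hnf ⟨i, hc⟩⟩
  obtain ⟨h1, h2⟩ := Nat.find_spec hex
  exact ⟨Nat.find hex, hop, h1, h2, fun j hj hlt hr => Nat.find_min hex hlt ⟨hj, hr⟩⟩

end SWMR

theorem mainTheorem2 {V : Type*} (n t : ℕ) (ht : 2 * t < n) (w : Fin n) (v₀ : V)
    (H : SWMR.Schedule n V) (hH : SWMR.IsRun t w v₀ H) :
    SWMR.Terminating H ∧ SWMR.Atomic v₀ H ∧
      ∀ (time : ℕ → ℝ) (Δ : ℝ), 0 ≤ Δ → SWMR.BoundedDelay t w v₀ H time Δ →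
        SWMR.TimeEfficient w H time Δ :=
  ⟨hH.terminating (by omega), hH.atomic ht, fun _ _ hΔ hB => hH.timeEfficient (by omega) hB hΔ⟩
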